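/- Let $\lambda\in H^1(\mathbb R)$ be real-valued, identified with its continuous representative, with weak derivative $\lambda'\in L^2(\mathbb R)$. For $g\in L^2(\mathbb R)$ put $\hat g(\omega)=\int g(t)e^{-i\omega t}\,dt$ (the $L^2$ Fourier transform) and $G_g(\omega)=\bigl(\sum_{k\in\mathbb Z}|\hat g(\omega+2k\pi)|^2\bigr)^{1/2}$. Assume that there are constants $A,B$ with $0<A\le G_\lambda(\omega)\le B<\infty$ for almost every $\omega$ and that $\sup_\omega G_{\lambda'}(\omega)/G_\lambda(\omega)<\infty$, and set $\tau=\pi\cdot\inf_\omega G_\lambda(\omega)/G_{\lambda'}(\omega)$ (supremum and infimum are essential ones). Let $V^2(\lambda)$ be the space of all functions $f(t)=\sum_{k\in\mathbb Z}c_k\lambda(t-k)$ with $(c_k)\in\ell^2(\mathbb Z)$ real. Given a nonempty set $E\subseteq V^2(\lambda)$ of input signals (for instance $E=V^2(\lambda)$), a time encoding machine (TEM) on $E$ maps each $f\in E$ to a strictly increasing sequence $(t_n)_{n\in\mathbb Z}$ of reals with $t_n\to\pm\infty$ as $n\to\pm\infty$. It is $T$-dense if $t_{n+1}-t_n\le T$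 for all $n$ and all outputs $(t_n)$, and invertible if there is a map $D$ from strictly increasing real sequences to $E$ with $D((t_n))=f$ whenever $(t_n)$ is the output for $f\in E$. It is a crossing TEM if there is a rule, the same for all $f$, which assigns to each $n$ and each set of past sampling times $\{t_i: i\le n-1\}$ a continuous function $\Phi_n:\mathbb R\to\mathbb R$, such that for every $f\in E$ and $n\in\mathbb Z$ one has $f(t_n)=\Phi_n(t_n)$ and $f(t)\ne\Phi_n(t)$ for all $t\in(t_{n-1},t_n)$. Then $0<\tau<\infty$, the elements of $V^2(\lambda)$ are continuous and square-integrable, and $V^2(\lambda)$ is closed in $L^2(\mathbb R)$; let $P$ be the orthogonal projector of $L^2(\mathbb R)$ onto $V^2(\lambda)$. For every $T<\tau$, every $T$-dense crossing TEM is invertible. Moreover, if $(t_n)$ is its output for $f\in E$, put $s_n=(t_{n-1}+t_n)/2$ and $Vg=\sum_{n\in\mathbb Z}g(t_n)\mathbf 1_{[s_n,s_{n+1})}$. Then $V$ maps $V^2(\lambda)$ into $L^2(\mathbb R)$, $Vf=\sum_{n\in\mathbb Z}\Phi_n(t_n)\mathbf 1_{[s_n,s_{n+1})}$ is determined by the output,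 and the sequence in $V^2(\lambda)$ given by $f_1=PVf$, $f_{k+1}=f_1+(\mathrm{Id}-PV)f_k$ satisfies, for all $k\ge1$, $$\|f-f_k\|_{L^2}\le\Bigl(\frac T\tau\Bigr)^k\|f\|_{L^2},$$ and $\|f-f_k\|_{L^2}\to0$ as $k\to\infty$. -/

import Mathlib

open MeasureTheory Filter Topology
open scoped ENNReal ContDiff FourierTransform

noncomputable section

/-! ### Sobolev space, Fourier transform and the function `G` -/

/-- `g` is the weak derivative of `f` on the real line. -/
def IsWeakDeriv (f g : ℝ → ℝ) : Prop :=
  ∀ φ : ℝ → ℝ, ContDiff ℝ ∞ φ → HasCompactSupport φ →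
    ∫ x, f x * deriv φ x = - ∫ x, g x * φ x

/-- `f` is the continuous representative of an element of `H¹(ℝ)`, and `f'` is its weak derivative
(unique up to a null set). -/
structure IsH1 (f f' : ℝ → ℝ) : Prop where
  continuous : Continuous f
  memLp : MemLp f 2 volume
  memLp_deriv : MemLp f' 2 volume
  weakDeriv : IsWeakDeriv f f'

/-- The `L²` Fourier transform `ω ↦ ∫ f(t) exp(-iωt) dt` of a real function in `L²(ℝ)`, defined
for almost every `ω`. The rescaling converts from the convention `exp(-2πiξt)`. -/
def hatL2 {f : ℝ → ℝ} (hf : MemLp f 2 volume) (w : ℝ) : ℂ :=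
  (𝓕 (MemLp.toLp (fun t => (f t : ℂ)) hf.ofReal) : Lp ℂ 2 (volume : Measure ℝ))
    (w / (2 * Real.pi))

/-- `G_f(ω) = (∑ₖ |f̂(ω + 2kπ)|²)^{1/2}`, with values in `[0, ∞]`. -/
def gFun {f : ℝ → ℝ} (hf : MemLp f 2 volume) (w : ℝ) : ℝ≥0∞ :=
  (∑' k : ℤ, ‖hatL2 hf (w + 2 * k * Real.pi)‖ₑ ^ 2) ^ (1 / 2 : ℝ)

/-- `τ = π · inf_ω G_λ(ω) / G_{λ'}(ω)`; the infimum is the essential one, since the `L²` Fourier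
transform is defined almost everywhere. -/
def tau {lam lam' : ℝ → ℝ} (h : IsH1 lam lam') : ℝ :=
  Real.pi * (essInf (fun w => gFun h.memLp w / gFun h.memLp_deriv w) volume).toReal

/-! ### The shift-invariant space and its orthogonal projector -/

/-- The shift-invariant space `V²(λ)` of all functions `f(t) = ∑ₖ cₖ λ(t - k)` with `c ∈ ℓ²(ℤ)`. -/
def V2 (lam : ℝ → ℝ) : Submodule ℝ (ℝ → ℝ) where
  carrier := {f | ∃ c : lp (fun _ : ℤ => ℝ) 2, ∀ t : ℝ,
    HasSum (fun k : ℤ => c k * lam (t - k)) (f t)}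
  zero_mem' := ⟨0, fun t => by simp⟩
  add_mem' := by
    rintro f g ⟨c, hc⟩ ⟨d, hd⟩
    exact ⟨c + d, fun t => by simpa [add_mul] using (hc t).add (hd t)⟩
  smul_mem' := by
    rintro a f ⟨c, hc⟩
    exact ⟨a • c, fun t => by simpa [mul_assoc] using (hc t).mul_left a⟩

/-- `V²(λ)` as a subspace of `L²(ℝ)`: the classes of its elements. -/
def V2L2 (lam : ℝ → ℝ) : Submodule ℝ (Lp ℝ 2 (volume : Measure ℝ)) where
  carrier := {F | ∃ f ∈ V2 lam, F =ᵐ[volume] f}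
  zero_mem' := ⟨0, (V2 lam).zero_mem, Lp.coeFn_zero _ _ _⟩
  add_mem' := by
    rintro F G ⟨f, hf, hF⟩ ⟨g, hg, hG⟩
    exact ⟨f + g, (V2 lam).add_mem hf hg, (Lp.coeFn_add F G).trans (hF.add hG)⟩
  smul_mem' := by
    rintro a F ⟨f, hf, hF⟩
    exact ⟨a • f, (V2 lam).smul_mem a hf, (Lp.coeFn_smul a F).trans (hF.const_smul a)⟩

/-- The orthogonal projector of `L²(ℝ)` onto the closed subspace spanned by `V²(λ)`, which is
`V²(λ)` itself as soon as that subspace is closed. -/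
def projL2 (lam : ℝ → ℝ) :
    Lp ℝ 2 (volume : Measure ℝ) →L[ℝ] Lp ℝ 2 (volume : Measure ℝ) :=
  (V2L2 lam).topologicalClosure.starProjection

/-- `g` is the element of `V²(λ)`, as a function defined at every point, which represents the
orthogonal projection of the square-integrable function `h`. -/
def IsProjOf (lam h g : ℝ → ℝ) : Prop :=
  g ∈ V2 lam ∧ ∃ hh : MemLp h 2 volume, projL2 lam (hh.toLp h) =ᵐ[volume] g

/-- The orthogonal projector `P` onto `V²(λ)`, with values genuine functions in `V²(λ)`. -/
def projV2 (lam h : ℝ → ℝ) : ℝ → ℝ :=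
  Classical.epsilon (IsProjOf lam h)

/-! ### The Voronoi operator and the iteration -/

/-- The function equal to `a n` on the Voronoi cell `[sₙ, sₙ₊₁)` of `tₙ`, with
`sₙ = (tₙ₋₁ + tₙ) / 2`. -/
def voronoiStep (t a : ℤ → ℝ) (x : ℝ) : ℝ :=
  ∑' n : ℤ, Set.indicator
    (Set.Ico ((t (n - 1) + t n) / 2) ((t n + t (n + 1)) / 2)) (fun _ => a n) x

/-- The Voronoi operator `(V f)(x) = ∑ₙ f(tₙ) 1_{[sₙ, sₙ₊₁)}(x)`. -/
def voronoiOp (t : ℤ → ℝ) (f : ℝ → ℝ) : ℝ → ℝ :=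
  voronoiStep t (fun n => f (t n))

/-- The operator `P V`. -/
def opPV (lam : ℝ → ℝ) (t : ℤ → ℝ) (f : ℝ → ℝ) : ℝ → ℝ :=
  projV2 lam (voronoiOp t f)

/-- The iteration `f₀ = f`, `f₁ = P V f₀`, `fₖ₊₁ = f₁ + (Id - P V) fₖ` for `k ≥ 1`. -/
def recon (lam : ℝ → ℝ) (t : ℤ → ℝ) (f : ℝ → ℝ) : ℕ → ℝ → ℝ
  | 0 => f
  | 1 => opPV lam t f
  | k + 2 => opPV lam t f + (recon lam t f (k + 1) - opPV lam t (recon lam t f (k + 1)))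

/-! ### Time encoding machines -/

/-- A time encoding machine on the set `E` of real functions. -/
structure TEM (E : Set (ℝ → ℝ)) where
  times : E → ℤ → ℝ
  strictMono : ∀ f, StrictMono (times f)
  tendsto_atTop : ∀ f, Tendsto (times f) atTop atTop
  tendsto_atBot : ∀ f, Tendsto (times f) atBot atBot

/-- Every output of the machine has gaps at most `T`. -/
def TEM.IsDense {E : Set (ℝ → ℝ)} (M : TEM E) (T : ℝ) : Prop :=
  ∀ f n, M.times f (n + 1) - M.times f n ≤ T

/-- The machine has an inverse (a time decoding machine). -/
def TEM.IsInvertible {E : Set (ℝ → ℝ)} (M : TEM E) : Prop :=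
  ∃ D : {t : ℤ → ℝ // StrictMono t} → E, ∀ f, D ⟨M.times f, M.strictMono f⟩ = f

/-- For the rule `Φ`, giving a continuous function for each index and each set of past sampling
times, the `n`-th test function `Φₙ` belonging to the sampling times `t`: it is determined by the
set `{tᵢ : i ≤ n - 1}`. -/
def testFun (Φ : ℤ → Set ℝ → C(ℝ, ℝ)) (t : ℤ → ℝ) (n : ℤ) : C(ℝ, ℝ) :=
  Φ n (t '' Set.Iic (n - 1))

/-- The machine is the crossing machine with test functions given by the rule `Φ`. -/
def TEM.IsCrossing {E : Set (ℝ → ℝ)} (M : TEM E) (Φ : ℤ → Set ℝ → C(ℝ, ℝ)) : Prop :=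
  ∀ (f : E) (n : ℤ),
    (f : ℝ → ℝ) (M.times f n) = testFun Φ (M.times f) n (M.times f n) ∧
    ∀ x ∈ Set.Ioo (M.times f (n - 1)) (M.times f n),
      (f : ℝ → ℝ) x ≠ testFun Φ (M.times f) n x

end

/-! The heart of the matter is that Id - PV contracts V²(λ) by the factor T/τ < 1. For g in V²(λ)
one has g = Pg, so ‖g - PVg‖ ≤ ‖g - Vg‖, and this norm is bounded by two inequalities.

Wirtinger: on the n-th Voronoi cell Vg equals g(tₙ), and both ends of the cell lie within T/2 of tₙ.
Hence ‖g - Vg‖ ≤ (T/π)‖g'‖ (`eLpNorm_sub_voronoiOp_le`). The sharp constant comes from a Schur test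
for the Volterra operator with a cosine weight (`lintegral_sq_volterra_le`).

Bernstein: ‖g'‖ ≤ (π/τ)‖g‖ on V²(λ) (`IsH1.exists_deriv_of_mem_V2`). Plancherel and periodization
give ‖∑ cₖ f(· - k)‖² = ∫₀¹ |∑ cₖ e^{-2πikξ}|² G_f(2πξ)² dξ for finite sums
(`eLpNorm_sum_translates_sq`), so a pointwise comparison of G_{λ'} with G_λ becomes a comparison of
norms. Comparing G_λ with the constants A and B in the same way shows that the translates of λ form
a Riesz sequence, whence V²(λ) is closed. `FamilyDominated` carries these comparisons from finite
sums to ℓ² series.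

The errors obey f - fₖ₊₁ = (Id - PV)(f - fₖ), which gives the geometric rate
(`recon_mem_and_eLpNorm_le`). Invertibility needs only injectivity: equal outputs force equal test
functions, hence equal samples, so V annihilates the difference of the two signals and the
contraction estimate makes it zero. -/

/-! ### Part: the sharp Volterra inequality on a half-gap. -/

/-- Cauchy--Schwarz for the Lebesgue integral with a weight `w`. -/
theorem lintegral_sq_le_lintegral_mul_lintegral_div {α : Type*} [MeasurableSpace α]
    (μ : Measure α) {h w : α → ℝ≥0∞} (hh : AEMeasurable h μ) (hw : AEMeasurable w μ)
    (hw0 : ∀ᵐ x ∂μ, w x ≠ 0) (hwt : ∀ᵐ x ∂μ, w x ≠ ⊤) :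
    (∫⁻ x, h x ∂μ) ^ 2 ≤ (∫⁻ x, w x ∂μ) * ∫⁻ x, h x ^ 2 / w x ∂μ := by
  have key := ENNReal.lintegral_mul_le_Lp_mul_Lq μ Real.HolderConjugate.two_two
    (f := fun x => w x ^ (1 / 2 : ℝ)) (g := fun x => h x / w x ^ (1 / 2 : ℝ))
    (hw.pow_const _) (hh.div (hw.pow_const _))
  have hsq : ∀ x : ℝ≥0∞, (x ^ (1 / 2 : ℝ)) ^ (2 : ℝ) = x := fun x => by
    rw [← ENNReal.rpow_mul]; norm_num
  have h1 : ∫⁻ x, h x ∂μ ≤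
      ∫⁻ x, ((fun x => w x ^ (1 / 2 : ℝ)) * fun x => h x / w x ^ (1 / 2 : ℝ)) x ∂μ := by
    refine lintegral_mono_ae ?_
    filter_upwards [hw0, hwt] with x h0 ht
    simp only [Pi.mul_apply]
    rw [ENNReal.mul_div_cancel]
    · simp [ENNReal.rpow_eq_zero_iff, h0, ht]
    · simp [ENNReal.rpow_eq_top_iff, h0, ht]
  have h2 := pow_le_pow_left' (h1.trans key) 2
  refine h2.trans (le_of_eq ?_)
  rw [mul_pow, ← ENNReal.rpow_two, ← ENNReal.rpow_two, hsq, hsq]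
  congr 1
  · simp_rw [hsq]
  · refine lintegral_congr fun x => ?_
    rw [ENNReal.div_rpow_of_nonneg _ _ zero_le_two, hsq, ENNReal.rpow_two]

theorem lintegral_Ioo_ofReal_eq_sub {F f : ℝ → ℝ} {a b : ℝ} (hab : a ≤ b) (hf : Continuous f)
    (hF : ∀ x, HasDerivAt F (f x) x) (h0 : ∀ x ∈ Set.Ioo a b, 0 ≤ f x) :
    ∫⁻ x in Set.Ioo a b, ENNReal.ofReal (f x) = ENNReal.ofReal (F b - F a) := by
  rw [← intervalIntegral.integral_eq_sub_of_hasDerivAt (fun x _ => hF x)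
    (hf.intervalIntegrable _ _), intervalIntegral.integral_of_le hab,
    ← integral_Ioc_eq_integral_Ioo.symm, ofReal_integral_eq_lintegral_ofReal]
  · exact (hf.integrableOn_Icc (a := a) (b := b)).mono_set Set.Ioo_subset_Icc_self
  · exact (ae_restrict_iff' measurableSet_Ioo).2 (ae_of_all _ h0)

/-- Sharp bound for the Volterra operator on `(0, L)`, by the Schur test with weight
`cos (π y / T)`. -/
theorem lintegral_sq_volterra_le {T L : ℝ} (hT : 0 < T) (hL : L ≤ T / 2) {h : ℝ → ℝ≥0∞}
    (hh : Measurable h) :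
    ∫⁻ x in Set.Ioo 0 L, (∫⁻ y in Set.Ioo 0 x, h y) ^ 2 ≤
      ENNReal.ofReal ((T / Real.pi) ^ 2) * ∫⁻ y in Set.Ioo 0 L, h y ^ 2 := by
  have hpi := Real.pi_pos
  -- The frequency is chosen so that cos(αy) first vanishes at y = T/2, the greatest admissible L;
  -- the weight is therefore positive on (0, L).
  obtain ⟨α, hα⟩ : ∃ α, α = Real.pi / T := ⟨_, rfl⟩
  have hα0 : 0 < α := by rw [hα]; positivity
  have hαT : α * (T / 2) = Real.pi / 2 := by rw [hα]; field_simp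
  have hrange : ∀ x, 0 ≤ x → x ≤ L → 0 ≤ α * x ∧ α * x ≤ Real.pi / 2 := fun x h0 h1 =>
    ⟨by positivity, by rw [← hαT]; exact mul_le_mul_of_nonneg_left (h1.trans hL) hα0.le⟩
  have hcos : ∀ x, 0 < x → x < L → 0 < Real.cos (α * x) := fun x h0 h1 => by
    apply Real.cos_pos_of_mem_Ioo
    have : α * x < α * (T / 2) := mul_lt_mul_of_pos_left (h1.trans_le hL) hα0
    have : 0 < α * x := by positivity
    constructor <;> linarith
  set w : ℝ → ℝ≥0∞ := fun y => ENNReal.ofReal (Real.cos (α * y)) with hw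
  have hwm : Measurable w := by fun_prop
  have hdsin : ∀ x, HasDerivAt (fun y => Real.sin (α * y) / α) (Real.cos (α * x)) x := fun x => by
    have := ((hasDerivAt_id x).const_mul α).sin.div_const α
    refine this.congr_deriv ?_
    simp only [mul_one, id_eq]; field_simp
  have hdcos : ∀ x, HasDerivAt (fun y => -Real.cos (α * y) / α ^ 2)
      (Real.sin (α * x) / α) x := fun x => by
    have := ((hasDerivAt_id x).const_mul α).cos.neg.div_const (α ^ 2)
    refine this.congr_deriv ?_
    simp only [mul_one, id_eq]; field_simp
  -- `p x` is the integral of the weight over (0, x), the first factor produced by Cauchy–Schwarz.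
  set p : ℝ → ℝ≥0∞ := fun x => ENNReal.ofReal (Real.sin (α * x) / α) with hp
  have hpm : Measurable p := by fun_prop
  set q : ℝ → ℝ≥0∞ := fun y => h y ^ 2 / w y with hq
  have hqm : Measurable q := (hh.pow_const 2).div hwm
  have step1 : ∀ x ∈ Set.Ioo 0 L, (∫⁻ y in Set.Ioo 0 x, h y) ^ 2 ≤
      p x * ∫⁻ y in Set.Ioo 0 x, q y := by
    intro x hx
    refine (lintegral_sq_le_lintegral_mul_lintegral_div _ hh.aemeasurable hwm.aemeasurable
      ?_ (ae_of_all _ fun _ => ENNReal.ofReal_ne_top)).trans_eq ?_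
    · refine (ae_restrict_iff' measurableSet_Ioo).2 (ae_of_all _ fun y hy => ?_)
      simpa [hw] using hcos y hy.1 (hy.2.trans hx.2)
    · congr 1
      rw [lintegral_Ioo_ofReal_eq_sub hx.1.le (by fun_prop) hdsin]
      · simp [hp]
      · exact fun y hy => (hcos y hy.1 (hy.2.trans hx.2)).le
  calc _ ≤ ∫⁻ x in Set.Ioo 0 L, p x * ∫⁻ y in Set.Ioo 0 x, q y :=
        setLIntegral_mono' measurableSet_Ioo step1
    -- The constraint y < x moves into an indicator, so that Tonelli applies on a fixed square.
    _ = ∫⁻ x in Set.Ioo 0 L, ∫⁻ y in Set.Ioo 0 L,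
          (Set.Ioi y).indicator p x * q y := by
        refine setLIntegral_congr_fun measurableSet_Ioo fun x hx => ?_
        rw [← lintegral_const_mul _ hqm, ← lintegral_indicator measurableSet_Ioo,
          ← lintegral_indicator measurableSet_Ioo]
        refine lintegral_congr fun y => ?_
        by_cases h1 : y ∈ Set.Ioo 0 x
        · rw [Set.indicator_of_mem h1, Set.indicator_of_mem (show y ∈ Set.Ioo 0 L from ⟨h1.1, h1.2.trans hx.2⟩),
            Set.indicator_of_mem (show x ∈ Set.Ioi y from h1.2)]
        · rw [Set.indicator_of_notMem h1]
          by_cases h2 : y ∈ Set.Ioo 0 L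
          · rw [Set.indicator_of_mem h2, Set.indicator_of_notMem, zero_mul]
            exact fun h3 => h1 ⟨h2.1, h3⟩
          · rw [Set.indicator_of_notMem h2]
    _ = ∫⁻ y in Set.Ioo 0 L, ∫⁻ x in Set.Ioo 0 L, (Set.Ioi y).indicator p x * q y := by
        refine lintegral_lintegral_swap (Measurable.aemeasurable ?_)
        have : Function.uncurry (fun x y => (Set.Ioi y).indicator p x * q y) =
            fun z : ℝ × ℝ => ({z : ℝ × ℝ | z.2 < z.1}.indicator (fun z => p z.1) z) * q z.2 := by
          ext z; simp [Set.indicator, Function.uncurry]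
        rw [this]
        exact ((hpm.comp measurable_fst).indicator
          (measurableSet_lt measurable_snd measurable_fst)).mul (hqm.comp measurable_snd)
    _ ≤ ∫⁻ y in Set.Ioo 0 L, ENNReal.ofReal ((T / Real.pi) ^ 2) * h y ^ 2 := by
        refine setLIntegral_mono' measurableSet_Ioo fun y hy => ?_
        rw [lintegral_mul_const _ (hpm.indicator measurableSet_Ioi),
          setLIntegral_indicator measurableSet_Ioi]
        have hset : Set.Ioi y ∩ Set.Ioo 0 L = Set.Ioo y L := by
          ext z; simp only [Set.mem_inter_iff, Set.mem_Ioi, Set.mem_Ioo]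
          exact ⟨fun h => ⟨h.1, h.2.2⟩, fun h => ⟨h.1, hy.1.trans h.1, h.2⟩⟩
        rw [hset, lintegral_Ioo_ofReal_eq_sub hy.2.le (by fun_prop) hdcos]
        · have hc0 := hcos y hy.1 hy.2
          have hcL : 0 ≤ Real.cos (α * L) := by
            obtain ⟨h0, h1⟩ := hrange L (hy.1.trans hy.2).le le_rfl
            exact Real.cos_nonneg_of_mem_Icc ⟨by linarith, h1⟩
          -- Integrating `p` over (y, L) gives (cos αy - cos αL)/α² ≤ (T/π)² cos αy: the weight
          -- reproduces itself and cancels the denominator of `q y`.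
          have hle : ENNReal.ofReal (-Real.cos (α * L) / α ^ 2 - -Real.cos (α * y) / α ^ 2) ≤
              ENNReal.ofReal ((T / Real.pi) ^ 2) * w y := by
            rw [hw, ← ENNReal.ofReal_mul (by positivity)]
            refine ENNReal.ofReal_le_ofReal ?_
            have : (T / Real.pi) ^ 2 = 1 / α ^ 2 := by rw [hα]; field_simp
            rw [this, ← sub_div, one_div_mul_eq_div]
            refine div_le_div_of_nonneg_right ?_ (sq_nonneg α)
            linarith
          refine (mul_le_mul_left hle _).trans_eq ?_
          rw [mul_assoc, hq]
          congr 1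
          rw [ENNReal.mul_div_cancel]
          · simpa [hw] using hc0
          · exact ENNReal.ofReal_ne_top
        · intro x hx
          obtain ⟨h0, h1⟩ := hrange x (hy.1.trans hx.1).le hx.2.le
          exact div_nonneg (Real.sin_nonneg_of_nonneg_of_le_pi h0 (by linarith)) hα0.le
    _ = _ := lintegral_const_mul _ (hh.pow_const 2)

/-! ### Part: the fundamental theorem of calculus for weak derivatives. -/

/-- The definition of the weak derivative, tested with the smoothed indicator function
`x ↦ ∫ y in (x - b)..(x - a), η y` of `(a, b)`. -/
theorem IsWeakDeriv.integral_mul_sub {f f' η : ℝ → ℝ} (h : IsWeakDeriv f f')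
    (hη : ContDiff ℝ ∞ η) (hc : HasCompactSupport η) (a b : ℝ) :
    ∫ x, f x * (η (x - a) - η (x - b)) = -∫ x, f' x * ∫ y in (x - b)..(x - a), η y := by
  have hcont : Continuous η := hη.continuous
  have hd : ∀ x, HasDerivAt (fun x => ∫ y in (x - b)..(x - a), η y) (η (x - a) - η (x - b)) x := by
    intro x
    have h0 : ∀ x c, HasDerivAt (fun x => ∫ y in (0 : ℝ)..(x - c), η y) (η (x - c)) x := by
      intro x c
      have h1 := (hcont.integral_hasStrictDerivAt 0 (x - c)).hasDerivAt
      simpa using HasDerivAt.comp_sub_const x c h1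
    refine ((h0 x a).sub (h0 x b)).congr_of_eventuallyEq (Eventually.of_forall fun x => ?_)
    simp only [Pi.sub_apply]
    rw [intervalIntegral.integral_interval_sub_left (hcont.intervalIntegrable _ _)
      (hcont.intervalIntegrable _ _)]
  have hderiv : deriv (fun x => ∫ y in (x - b)..(x - a), η y) = fun x => η (x - a) - η (x - b) :=
    funext fun x => (hd x).deriv
  rw [← h]
  · rw [hderiv]
  · refine contDiff_infty_iff_deriv.2 ⟨fun x => (hd x).differentiableAt, ?_⟩
    rw [hderiv]
    exact (hη.comp (contDiff_id.sub contDiff_const)).sub (hη.comp (contDiff_id.sub contDiff_const))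
  · obtain ⟨R, hR⟩ := hc.isCompact.isBounded.subset_closedBall 0
    have hz : ∀ y, R < |y| → η y = 0 := fun y hy => by
      by_contra h0
      have := hR (subset_tsupport _ h0)
      simp at this; linarith
    refine HasCompactSupport.of_support_subset_isCompact
      (isCompact_Icc (a := -(|R| + |a| + |b|)) (b := |R| + |a| + |b|)) fun x hx => ?_
    by_contra hxn
    refine hx (intervalIntegral.integral_zero_ae (ae_of_all _ fun y hy => hz y ?_))
    -- For such x the whole window between x - b and x - a misses the support of η; the order of a
    -- and b is not fixed here.
    have hx' : |R| + |a| + |b| < |x| := by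
      by_contra h2
      exact hxn (abs_le.1 (not_lt.1 h2))
    have hRR := le_abs_self R
    rw [Set.mem_uIoc] at hy
    rcases abs_cases x with h3 | h3 <;> rcases abs_cases y with h4 | h4 <;>
    rcases abs_cases a with h5 | h5 <;> rcases abs_cases b with h6 | h6 <;>
    rcases hy with hy | hy <;> linarith [abs_nonneg R]

/-- A continuous function with a locally integrable weak derivative satisfies the fundamental
theorem of calculus. -/
theorem IsWeakDeriv.sub_eq_integral {f f' : ℝ → ℝ} (h : IsWeakDeriv f f') (hf : Continuous f)
    (hf' : LocallyIntegrable f') {a b : ℝ} (hab : a < b) :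
    f b - f a = ∫ x in a..b, f' x := by
  let φ : ℕ → ContDiffBump (0 : ℝ) := fun n =>
    ⟨1 / (n + 2 : ℝ) / 2, 1 / (n + 2 : ℝ), by positivity, by
      have : (0 : ℝ) < 1 / (n + 2 : ℝ) := by positivity
      linarith⟩
  have hφ : Tendsto (fun n => (φ n).rOut) atTop (𝓝 0) := by
    have := (tendsto_const_div_atTop_nhds_zero_nat (1 : ℝ)).comp (tendsto_add_atTop_nat 2)
    refine this.congr fun n => ?_
    simp [φ]
  have hφ1 : ∀ n, (φ n).rOut ≤ 1 := fun n => by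
    simp only [φ]
    rw [div_le_one (by positivity)]
    linarith [(Nat.cast_nonneg n : (0 : ℝ) ≤ n)]
  set η : ℕ → ℝ → ℝ := fun n => (φ n).normed volume with hηdef
  have hηc : ∀ n, Continuous (η n) := fun n => (φ n).continuous_normed
  have hη0 : ∀ n y, (φ n).rOut ≤ |y| → η n y = 0 := fun n y hy => by
    by_contra h0
    have h1 : y ∈ Function.support (η n) := h0
    rw [hηdef, ContDiffBump.support_normed_eq] at h1
    simp at h1; linarith
  -- The normed bumps are even, so this correlation is a convolution, and approximate-identity
  -- convergence is available.
  have hconv : ∀ n c, ∫ x, f x * η n (x - c) =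
      (convolution (η n) f (ContinuousLinearMap.lsmul ℝ ℝ) volume) c := by
    intro n c
    rw [convolution_def, ← integral_sub_left_eq_self (fun x => f x * η n (x - c)) volume c]
    refine integral_congr_ae (ae_of_all _ fun x => ?_)
    simp only [ContinuousLinearMap.lsmul_apply, smul_eq_mul]
    rw [show c - x - c = -x by ring, mul_comm, show η n (-x) = η n x from (φ n).normed_neg x]
  have hint : ∀ n c, Integrable (fun x => f x * η n (x - c)) := fun n c =>
    (hf.mul ((hηc n).comp (continuous_sub_right c))).integrable_of_hasCompactSupport
      (HasCompactSupport.mul_left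
        ((φ n).hasCompactSupport_normed.comp_homeomorph (Homeomorph.subRight c)))
  have hlim1 : Tendsto (fun n => ∫ x, f x * (η n (x - a) - η n (x - b))) atTop
      (𝓝 (f a - f b)) := by
    have := (ContDiffBump.convolution_tendsto_right_of_continuous (μ := volume) hφ hf a).sub
      (ContDiffBump.convolution_tendsto_right_of_continuous (μ := volume) hφ hf b)
    refine this.congr fun n => ?_
    rw [← hconv, ← hconv, ← integral_sub (hint n a) (hint n b)]
    simp_rw [mul_sub]
  have hηi : ∀ n, Integrable (η n) := fun n => (φ n).integrable_normed
  have hη1 : ∀ n, ∫ y, η n y = 1 := fun n => (φ n).integral_normed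
  have hηn : ∀ n y, 0 ≤ η n y := fun n y => (φ n).nonneg_normed y
  have hΦ : ∀ n x, ∫ y in (x - b)..(x - a), η n y = ∫ y in Set.Ioc (x - b) (x - a), η n y :=
    fun n x => intervalIntegral.integral_of_le (by linarith)
  -- The smoothed indicators are at most 1 and, the radii being at most 1, vanish off [a - 1, b +
  -- 1], so |f'| on that interval dominates. They converge to the indicator of (a, b) away from the
  -- two end points, a null set.
  have hlim2 : Tendsto (fun n => ∫ x, f' x * ∫ y in (x - b)..(x - a), η n y) atTop
      (𝓝 (∫ x, (Set.Ioo a b).indicator f' x)) := by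
    refine tendsto_integral_of_dominated_convergence
      (fun x => (Set.Icc (a - 1) (b + 1)).indicator (fun x => ‖f' x‖) x) (fun n => ?_) ?_ ?_ ?_
    · refine hf'.aestronglyMeasurable.mul (Continuous.aestronglyMeasurable ?_)
      have : (fun x => ∫ y in (x - b)..(x - a), η n y) =
          fun x => (∫ y in (0 : ℝ)..(x - a), η n y) - ∫ y in (0 : ℝ)..(x - b), η n y := by
        ext x
        rw [intervalIntegral.integral_interval_sub_left ((hηc n).intervalIntegrable _ _)
          ((hηc n).intervalIntegrable _ _)]
      rw [this]
      have h0 := intervalIntegral.continuous_primitive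
        (fun a b => (hηc n).intervalIntegrable (μ := volume) a b) 0
      exact (h0.comp (continuous_sub_right a)).sub (h0.comp (continuous_sub_right b))
    · have := hf'.integrableOn_isCompact (isCompact_Icc (a := a - 1) (b := b + 1))
      exact (IntegrableOn.integrable_indicator this.norm measurableSet_Icc)
    · intro n
      refine ae_of_all _ fun x => ?_
      rw [norm_mul]
      by_cases hx : x ∈ Set.Icc (a - 1) (b + 1)
      · rw [Set.indicator_of_mem hx]
        refine mul_le_of_le_one_right (norm_nonneg _) ?_
        rw [hΦ, Real.norm_of_nonneg (integral_nonneg fun y => hηn n y), ← hη1 n]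
        exact setIntegral_le_integral (hηi n) (ae_of_all _ (hηn n))
      · rw [Set.indicator_of_notMem hx, intervalIntegral.integral_zero_ae, norm_zero, mul_zero]
        refine ae_of_all _ fun y hy => hη0 n y ?_
        rw [Set.uIoc_of_le (by linarith)] at hy
        rw [Set.mem_Icc, not_and_or, not_le, not_le] at hx
        have := hφ1 n
        rcases hx with hx | hx <;> rcases abs_cases y with h4 | h4 <;> linarith [hy.1, hy.2]
    · have hab' : ∀ᵐ x : ℝ, x ∉ ({a, b} : Set ℝ) :=
        measure_eq_zero_iff_ae_notMem.1 ((Set.toFinite _).measure_zero _)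
      filter_upwards [hab'] with x hx
      simp only [Set.mem_insert_iff, Set.mem_singleton_iff, not_or] at hx
      by_cases hx' : x ∈ Set.Ioo a b
      · rw [Set.indicator_of_mem hx']
        have hev : ∀ᶠ n in atTop, (φ n).rOut < min (x - a) (b - x) :=
          hφ.eventually_lt_const (lt_min (by linarith [hx'.1]) (by linarith [hx'.2]))
        refine tendsto_const_nhds.congr' ?_
        filter_upwards [hev] with n hn
        rw [hΦ, setIntegral_eq_integral_of_forall_compl_eq_zero, hη1, mul_one]
        intro y hy
        refine hη0 n y ?_
        rw [lt_min_iff] at hn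
        rw [Set.mem_Ioc, not_and_or, not_lt, not_le] at hy
        rcases hy with hy | hy <;> rcases abs_cases y with h4 | h4 <;> linarith
      · rw [Set.indicator_of_notMem hx']
        have hx2 : x < a ∨ b < x := by
          rw [Set.mem_Ioo, not_and_or, not_lt, not_lt] at hx'
          exact hx'.imp (fun h => lt_of_le_of_ne h hx.1) fun h => lt_of_le_of_ne h (Ne.symm hx.2)
        have hev : ∀ᶠ n in atTop, (φ n).rOut < max (a - x) (x - b) :=
          hφ.eventually_lt_const (lt_max_iff.2 (hx2.imp (by intro; linarith) (by intro; linarith)))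
        refine tendsto_const_nhds.congr' ?_
        filter_upwards [hev] with n hn
        rw [intervalIntegral.integral_zero_ae, mul_zero]
        refine ae_of_all _ fun y hy => hη0 n y ?_
        rw [Set.uIoc_of_le (by linarith)] at hy
        rw [lt_max_iff] at hn
        rcases hn with hn | hn <;> rcases abs_cases y with h4 | h4 <;> linarith [hy.1, hy.2]
  have heq : ∀ n, ∫ x, f x * (η n (x - a) - η n (x - b)) =
      -∫ x, f' x * ∫ y in (x - b)..(x - a), η n y := fun n =>
    h.integral_mul_sub (φ n).contDiff_normed (φ n).hasCompactSupport_normed a b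
  have hfin := tendsto_nhds_unique hlim1 (hlim2.neg.congr fun n => (heq n).symm)
  rw [integral_indicator measurableSet_Ioo, ← integral_Ioc_eq_integral_Ioo,
    ← intervalIntegral.integral_of_le hab.le] at hfin
  linarith

theorem IsH1.locallyIntegrable_deriv {f f' : ℝ → ℝ} (h : IsH1 f f') : LocallyIntegrable f' :=
  h.memLp_deriv.locallyIntegrable one_le_two

theorem IsH1.sub_eq_integral {f f' : ℝ → ℝ} (h : IsH1 f f') (a b : ℝ) :
    f b - f a = ∫ x in a..b, f' x := by
  rcases lt_trichotomy a b with hab | rfl | hab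
  · exact h.weakDeriv.sub_eq_integral h.continuous h.locallyIntegrable_deriv hab
  · simp
  · rw [intervalIntegral.integral_symm,
      ← h.weakDeriv.sub_eq_integral h.continuous h.locallyIntegrable_deriv hab, neg_sub]

/-! ### Part: translates, periodization and Parseval on the Fourier side. -/

open scoped RealInnerProductSpace in
/-- The Fourier transform on `L²` turns translations into modulations. -/
theorem Lp.fourier_comp_sub (F : Lp ℂ 2 (volume : Measure ℝ)) (a : ℝ) :
    (𝓕 (Lp.compMeasurePreserving (· - a) (measurePreserving_sub_right volume a) F) :
      Lp ℂ 2 (volume : Measure ℝ)) =ᵐ[volume]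
      fun ξ => (Real.fourierChar (-(a * ξ)) : ℂ) * (𝓕 F : Lp ℂ 2 (volume : Measure ℝ)) ξ := by
  have hn : ∀ (u : ℝ → ℂ) (ξ : ℝ), ‖(Real.fourierChar (-(a * ξ)) : ℂ) * u ξ‖ = ‖u ξ‖ := by
    intro u ξ; rw [norm_mul, Circle.norm_coe, one_mul]
  have hm : ∀ G : Lp ℂ 2 (volume : Measure ℝ),
      MemLp (fun ξ => (Real.fourierChar (-(a * ξ)) : ℂ) * G ξ) 2 volume := fun G => by
    refine (Lp.memLp G).of_le (AEStronglyMeasurable.mul ?_ (Lp.aestronglyMeasurable G))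
      (ae_of_all _ fun ξ => (hn G ξ).le)
    exact Continuous.aestronglyMeasurable (by fun_prop)
  -- Multiplication by the unimodular character, as an isometry of L². Both sides are then
  -- continuous in `F`, and it suffices to check Schwartz functions.
  set m : Lp ℂ 2 (volume : Measure ℝ) → Lp ℂ 2 (volume : Measure ℝ) := fun G => (hm G).toLp
  have hiso : Isometry m := by
    refine Isometry.of_dist_eq fun G H => ?_
    rw [dist_eq_norm, dist_eq_norm, Lp.norm_def, Lp.norm_def]
    congr 1
    refine eLpNorm_congr_norm_ae ?_
    filter_upwards [Lp.coeFn_sub (m G) (m H), Lp.coeFn_sub G H, (hm G).coeFn_toLp,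
      (hm H).coeFn_toLp] with ξ h1 h2 h3 h4
    rw [h1, h2, Pi.sub_apply, Pi.sub_apply, h3, h4, ← mul_sub]
    exact hn (fun _ => G ξ - H ξ) ξ
  suffices h : 𝓕 (Lp.compMeasurePreserving (· - a) (measurePreserving_sub_right volume a) F) =
      m (𝓕 F) by
    rw [h]; exact (hm _).coeFn_toLp
  refine DenseRange.induction_on (p := fun F : Lp ℂ 2 (volume : Measure ℝ) =>
    𝓕 (Lp.compMeasurePreserving (· - a) (measurePreserving_sub_right volume a) F) = m (𝓕 F))
    (SchwartzMap.denseRange_toLpCLM (E := ℝ) (F := ℂ) (p := 2) (μ := (volume : Measure ℝ))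
      ENNReal.ofNat_ne_top) F (isClosed_eq ?_ ?_) fun f => ?_
  · exact (Lp.fourierTransformₗᵢ ℝ ℂ).continuous.comp
      (Lp.isometry_compMeasurePreserving (measurePreserving_sub_right volume a)).continuous
  · exact hiso.continuous.comp (Lp.fourierTransformₗᵢ ℝ ℂ).continuous
  · have h1 : Lp.compMeasurePreserving (· - a) (measurePreserving_sub_right volume a)
        (f.toLp 2 volume) = (f.compSubConstCLM ℂ a).toLp 2 volume := by
      refine Lp.ext ?_
      refine (Lp.coeFn_compMeasurePreserving _ _).trans ?_
      have h2 := (measurePreserving_sub_right volume a).quasiMeasurePreserving.ae_eq_comp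
        (f.coeFn_toLp 2 volume)
      refine h2.trans (((f.compSubConstCLM ℂ a).coeFn_toLp 2 volume).mono fun x hx => ?_)
      rw [hx]; rfl
    change 𝓕 (Lp.compMeasurePreserving (· - a) (measurePreserving_sub_right volume a)
      (f.toLp 2 volume)) = m (𝓕 (f.toLp 2 volume))
    rw [h1, SchwartzMap.toLp_fourier_eq, SchwartzMap.toLp_fourier_eq]
    refine Lp.ext ?_
    refine ((𝓕 (f.compSubConstCLM ℂ a)).coeFn_toLp 2 volume).trans ?_
    filter_upwards [(hm ((𝓕 f).toLp 2 volume)).coeFn_toLp, (𝓕 f).coeFn_toLp 2 volume] with ξ h2 h3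
    rw [h2, h3, SchwartzMap.fourier_coe, SchwartzMap.fourier_coe]
    have h4 := congrFun (VectorFourier.fourierIntegral_comp_add_right Real.fourierChar volume
      (innerₗ ℝ) f (-a)) ξ
    simp only [VectorFourier.fourierIntegral, innerₗ_apply_apply] at h4
    rw [Real.fourier_eq, Real.fourier_eq]
    simp only [SchwartzMap.compSubConstCLM_apply, sub_eq_add_neg]
    refine h4.trans ?_
    rw [show ⟪-a, ξ⟫ = -(a * ξ) by simp [mul_comm]]
    rfl

/-- Periodization of a Lebesgue integral. -/
theorem lintegral_eq_lintegral_Ioc_tsum {h : ℝ → ℝ≥0∞} (hh : AEMeasurable h) :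
    ∫⁻ x, h x = ∫⁻ x in Set.Ioc (0 : ℝ) 1, ∑' n : ℤ, h (x + n) := by
  have hmp : ∀ n : ℤ, MeasurePreserving (fun x : ℝ => x + n) volume volume := fun n =>
    measurePreserving_add_right volume (n : ℝ)
  rw [← setLIntegral_univ, ← iUnion_Ioc_add_intCast (0 : ℝ),
    lintegral_iUnion (fun n => measurableSet_Ioc) (Set.pairwise_disjoint_Ioc_add_intCast 0),
    lintegral_tsum (f := fun (n : ℤ) x => h (x + n)) fun n =>
      (hh.comp_quasiMeasurePreserving (hmp n).quasiMeasurePreserving).restrict]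
  refine tsum_congr fun n => ?_
  rw [← (hmp n).setLIntegral_comp_preimage_emb (measurableEmbedding_addRight (n : ℝ))]
  congr 2
  ext x
  simp only [Set.mem_preimage, Set.mem_Ioc]
  constructor <;> rintro ⟨h1, h2⟩ <;> constructor <;> linarith

/-- The trigonometric polynomial `∑_{k ∈ s} cₖ exp(-2πikξ)`. -/
noncomputable def trigPoly (s : Finset ℤ) (c : ℤ → ℝ) (ξ : ℝ) : ℂ :=
  ∑ k ∈ s, (c k : ℂ) * (Real.fourierChar (-(k * ξ)) : ℂ)

theorem continuous_trigPoly (s : Finset ℤ) (c : ℤ → ℝ) : Continuous (trigPoly s c) := by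
  unfold trigPoly; fun_prop

/-- Periodicity lets the trigonometric polynomial leave the periodizing sum, so only |𝓕f|² is
periodized. -/
theorem trigPoly_add_int (s : Finset ℤ) (c : ℤ → ℝ) (ξ : ℝ) (n : ℤ) :
    trigPoly s c (ξ + n) = trigPoly s c ξ := by
  refine Finset.sum_congr rfl fun k _ => ?_
  congr 1
  simp only [Real.fourierChar_apply]
  rw [Complex.exp_eq_exp_iff_exists_int]
  exact ⟨-(k * n), by push_cast; ring⟩

theorem norm_sq_trigPoly (s : Finset ℤ) (c : ℤ → ℝ) (ξ : ℝ) :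
    ‖trigPoly s c ξ‖ ^ 2 =
      ∑ k ∈ s, ∑ l ∈ s, c k * c l * Real.cos ((k - l : ℤ) * (2 * Real.pi * ξ)) := by
  have h : ∀ k : ℤ, (Real.fourierChar (-(k * ξ)) : ℂ) =
      Real.cos (k * (2 * Real.pi * ξ)) - Real.sin (k * (2 * Real.pi * ξ)) * Complex.I := by
    intro k
    rw [Real.fourierChar_apply, Complex.exp_mul_I, ← Complex.ofReal_cos, ← Complex.ofReal_sin,
      show 2 * Real.pi * -(k * ξ) = -(k * (2 * Real.pi * ξ)) by ring, Real.cos_neg, Real.sin_neg]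
    push_cast; ring
  have hre : (trigPoly s c ξ).re = ∑ k ∈ s, c k * Real.cos (k * (2 * Real.pi * ξ)) := by
    simp [trigPoly, h, Complex.re_sum, -Complex.ofReal_cos, -Complex.ofReal_sin]
  have him : (trigPoly s c ξ).im = -∑ k ∈ s, c k * Real.sin (k * (2 * Real.pi * ξ)) := by
    simp [trigPoly, h, Complex.im_sum, -Complex.ofReal_cos, -Complex.ofReal_sin]
  rw [← Complex.normSq_eq_norm_sq, Complex.normSq_apply, hre, him, neg_mul_neg,
    Finset.sum_mul_sum, Finset.sum_mul_sum, ← Finset.sum_add_distrib]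
  refine Finset.sum_congr rfl fun k _ => ?_
  rw [← Finset.sum_add_distrib]
  refine Finset.sum_congr rfl fun l _ => ?_
  push_cast
  rw [sub_mul, Real.cos_sub]; ring

theorem integral_cos_int_mul (m : ℤ) :
    ∫ x in (0 : ℝ)..1, Real.cos (m * (2 * Real.pi * x)) = if m = 0 then 1 else 0 := by
  split_ifs with h
  · simp [h]
  · have h0 : (m * (2 * Real.pi) : ℝ) ≠ 0 := by
      have := Real.pi_pos.ne'
      have : (m : ℝ) ≠ 0 := by exact_mod_cast h
      positivity
    simp_rw [← mul_assoc]
    rw [intervalIntegral.integral_comp_mul_left (fun y => Real.cos y) (by simpa [mul_assoc] using h0), integral_cos]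
    simp only [mul_zero, Real.sin_zero, mul_one, sub_zero]
    have h2 : Real.sin (m * 2 * Real.pi) = 0 := by
      simpa [mul_comm] using Real.sin_int_mul_pi (m * 2)
    rw [h2, smul_zero]

/-- Parseval's identity for trigonometric polynomials. -/
theorem lintegral_trigPoly (s : Finset ℤ) (c : ℤ → ℝ) :
    ∫⁻ ξ in Set.Ioc (0 : ℝ) 1, ‖trigPoly s c ξ‖ₑ ^ 2 = ENNReal.ofReal (∑ k ∈ s, c k ^ 2) := by
  have h1 : ∀ ξ, ‖trigPoly s c ξ‖ₑ ^ 2 = ENNReal.ofReal (‖trigPoly s c ξ‖ ^ 2) := fun ξ => by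
    rw [ENNReal.ofReal_pow (norm_nonneg _), ofReal_norm]
  simp_rw [h1]
  rw [← ofReal_integral_eq_lintegral_ofReal, ← intervalIntegral.integral_of_le zero_le_one]
  · congr 1
    simp_rw [norm_sq_trigPoly]
    rw [intervalIntegral.integral_finsetSum fun k _ =>
      Continuous.intervalIntegrable (by fun_prop) _ _]
    refine Finset.sum_congr rfl fun k hk => ?_
    rw [intervalIntegral.integral_finsetSum fun k _ =>
      Continuous.intervalIntegrable (by fun_prop) _ _]
    simp_rw [intervalIntegral.integral_const_mul, integral_cos_int_mul, sub_eq_zero]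
    simp [hk, sq]
  · exact (((continuous_trigPoly s c).norm.pow 2).integrableOn_Icc).mono_set Set.Ioc_subset_Icc_self
  · exact ae_of_all _ fun _ => by positivity

/-- The periodization of `|𝓕 f|²`. -/
noncomputable def periodization {f : ℝ → ℝ} (hf : MemLp f 2 volume) (ξ : ℝ) : ℝ≥0∞ :=
  ∑' n : ℤ, ‖(𝓕 (MemLp.toLp (fun t => (f t : ℂ)) hf.ofReal) : Lp ℂ 2 (volume : Measure ℝ))
    (ξ + n)‖ₑ ^ 2

/-- The substitution ω = 2πξ turns the shifts by 2kπ in `gFun` into integer shifts. -/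
theorem gFun_sq {f : ℝ → ℝ} (hf : MemLp f 2 volume) (ξ : ℝ) :
    gFun hf (2 * Real.pi * ξ) ^ 2 = periodization hf ξ := by
  have hpi := Real.pi_pos.ne'
  rw [gFun, ← ENNReal.rpow_two, ← ENNReal.rpow_mul]
  norm_num
  refine tsum_congr fun k => ?_
  rw [hatL2, show (2 * Real.pi * ξ + 2 * k * Real.pi) / (2 * Real.pi) = ξ + k by field_simp]

/-- The norm of a finite combination of integer translates on the Fourier side. -/
theorem eLpNorm_sum_translates_sq {f : ℝ → ℝ} (hf : MemLp f 2 volume) (s : Finset ℤ) (c : ℤ → ℝ) :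
    eLpNorm (fun t => ∑ k ∈ s, c k * f (t - k)) 2 volume ^ 2 =
      ∫⁻ ξ in Set.Ioc (0 : ℝ) 1, ‖trigPoly s c ξ‖ₑ ^ 2 * periodization hf ξ := by
  set F : Lp ℂ 2 (volume : Measure ℝ) := MemLp.toLp (fun t => (f t : ℂ)) hf.ofReal with hF
  set τ : ℤ → Lp ℂ 2 (volume : Measure ℝ) := fun k =>
    Lp.compMeasurePreserving (· - (k : ℝ)) (measurePreserving_sub_right volume (k : ℝ)) F with hτ
  have hτ' : ∀ k : ℤ, τ k =ᵐ[volume] fun t => (f (t - k) : ℂ) := fun k =>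
    (Lp.coeFn_compMeasurePreserving _ _).trans
      ((measurePreserving_sub_right volume (k : ℝ)).quasiMeasurePreserving.ae_eq_comp
        hf.ofReal.coeFn_toLp)
  set S : Lp ℂ 2 (volume : Measure ℝ) := ∑ k ∈ s, (c k : ℂ) • τ k with hS
  have hsum : ∀ (u : ℤ → Lp ℂ 2 (volume : Measure ℝ)),
      (∑ k ∈ s, (c k : ℂ) • u k : Lp ℂ 2 (volume : Measure ℝ)) =ᵐ[volume]
        fun t => ∑ k ∈ s, (c k : ℂ) * u k t := by
    intro u
    refine (Lp.coeFn_fun_finsetSum _ _).trans ?_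
    have := (eventually_all_finset s (l := ae (volume : Measure ℝ))).2
      fun k _ => Lp.coeFn_smul (c k : ℂ) (u k)
    filter_upwards [this] with t ht
    exact Finset.sum_congr rfl fun k hk => by rw [ht k hk]; rfl
  have h1 : eLpNorm (fun t => ∑ k ∈ s, c k * f (t - k)) 2 volume = eLpNorm S 2 volume := by
    refine eLpNorm_congr_norm_ae ?_
    have := (eventually_all_finset s (l := ae (volume : Measure ℝ))).2 fun k _ => hτ' k
    filter_upwards [hsum τ, this] with t h2 h3
    rw [h2, ← Complex.norm_real, Complex.ofReal_sum]
    congr 1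
    exact Finset.sum_congr rfl fun k hk => by rw [h3 k hk, Complex.ofReal_mul]
  have h2 : eLpNorm S 2 volume = eLpNorm (𝓕 S : Lp ℂ 2 (volume : Measure ℝ)) 2 volume := by
    rw [← Lp.enorm_def, ← Lp.enorm_def, ← ofReal_norm, ← ofReal_norm, Lp.norm_fourier_eq]
  have h3 : (𝓕 S : Lp ℂ 2 (volume : Measure ℝ)) =ᵐ[volume] fun ξ =>
      trigPoly s c ξ * (𝓕 F : Lp ℂ 2 (volume : Measure ℝ)) ξ := by
    have h4 : 𝓕 S = ∑ k ∈ s, (c k : ℂ) • 𝓕 (τ k) := by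
      change Lp.fourierTransformₗᵢ ℝ ℂ S = _
      rw [hS, map_sum]
      exact Finset.sum_congr rfl fun k _ => map_smul _ _ _
    rw [h4]
    have := (eventually_all_finset s (l := ae (volume : Measure ℝ))).2
      fun (k : ℤ) _ => Lp.fourier_comp_sub F (k : ℝ)
    filter_upwards [hsum fun k => 𝓕 (τ k), this] with ξ h5 h6
    rw [h5, trigPoly, Finset.sum_mul]
    exact Finset.sum_congr rfl fun k hk => by rw [h6 k hk, mul_assoc]
  have hsq : ∀ u : ℝ → ℂ, eLpNorm u 2 volume ^ 2 = ∫⁻ ξ, ‖u ξ‖ₑ ^ 2 := fun u => by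
    have := eLpNorm_nnreal_pow_eq_lintegral (f := u) (μ := volume) (p := 2) two_ne_zero
    simpa using this
  rw [h1, h2, eLpNorm_congr_ae h3, hsq, lintegral_eq_lintegral_Ioc_tsum]
  · refine lintegral_congr fun ξ => ?_
    rw [periodization, ← ENNReal.tsum_mul_left]
    refine tsum_congr fun n => ?_
    rw [trigPoly_add_int, enorm_mul, mul_pow]
  · exact (((continuous_trigPoly s c).aestronglyMeasurable.mul
      (Lp.aestronglyMeasurable _)).enorm.pow_const 2)

/-! ### Comparison of families of vectors -/

section Comparison

variable {ι H₁ H₂ : Type*} [NormedAddCommGroup H₁] [NormedSpace ℝ H₁] [NormedAddCommGroup H₂]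
  [NormedSpace ℝ H₂]

/-- Every finite combination of the `v k` is at most `K` times as long as that of the `u k`. -/
def FamilyDominated (K : ℝ) (v : ι → H₂) (u : ι → H₁) : Prop :=
  ∀ (s : Finset ι) (c : ι → ℝ), ‖∑ k ∈ s, c k • v k‖ ≤ K * ‖∑ k ∈ s, c k • u k‖

/-- Domination of finite sums transfers the Cauchy criterion from one family to the other. -/
theorem FamilyDominated.summable [CompleteSpace H₂] {K : ℝ} {v : ι → H₂} {u : ι → H₁}
    (h : FamilyDominated K v u) (hK : 0 ≤ K) {c : ι → ℝ} (hc : Summable fun k => c k • u k) :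
    Summable fun k => c k • v k := by
  rw [summable_iff_vanishing_norm]
  intro ε hε
  -- `K` may be 0, so the tolerance is divided by `K + 1`.
  have hK1 : 0 < K + 1 := by linarith
  obtain ⟨s, hs⟩ := hc.vanishing (Metric.ball_mem_nhds 0 (div_pos hε hK1))
  refine ⟨s, fun t ht => ?_⟩
  have h1 : ‖∑ k ∈ t, c k • u k‖ < ε / (K + 1) := mem_ball_zero_iff.1 (hs t ht)
  have h2 : ‖∑ k ∈ t, c k • v k‖ ≤ K * ‖∑ k ∈ t, c k • u k‖ := h t c
  rw [lt_div_iff₀ hK1] at h1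
  have h3 := norm_nonneg (∑ k ∈ t, c k • u k)
  linarith

theorem FamilyDominated.norm_le {K : ℝ} {v : ι → H₂} {u : ι → H₁} (h : FamilyDominated K v u)
    {c : ι → ℝ} {x : H₁} {y : H₂} (hx : HasSum (fun k => c k • u k) x)
    (hy : HasSum (fun k => c k • v k) y) : ‖y‖ ≤ K * ‖x‖ :=
  le_of_tendsto_of_tendsto' (Tendsto.norm hy) ((Tendsto.norm hx).const_mul K) fun s => h s c

end Comparison

/-- The standard unit vectors of `ℓ²(ℤ)`. -/
noncomputable def unitVec (k : ℤ) : lp (fun _ : ℤ => ℝ) 2 := lp.single 2 k 1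

theorem smul_unitVec (c : ℝ) (k : ℤ) : c • unitVec k = lp.single 2 k c := by
  rw [unitVec, ← lp.single_smul, smul_eq_mul, mul_one]

theorem hasSum_smul_unitVec (c : lp (fun _ : ℤ => ℝ) 2) :
    HasSum (fun k => c k • unitVec k) c := by
  simp_rw [smul_unitVec]
  exact lp.hasSum_single ENNReal.ofNat_ne_top c

theorem norm_sum_smul_unitVec_sq (s : Finset ℤ) (c : ℤ → ℝ) :
    ‖∑ k ∈ s, c k • unitVec k‖ ^ 2 = ∑ k ∈ s, c k ^ 2 := by
  simp_rw [smul_unitVec]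
  have := lp.norm_sum_single (E := fun _ : ℤ => ℝ) (p := 2) (by norm_num) c s
  simpa using this

/-! ### Integer translates of a square-integrable function -/

/-- The class in `L²` of the translate `f (· - k)`. -/
noncomputable def translateLp {f : ℝ → ℝ} (hf : MemLp f 2 volume) (k : ℤ) :
    Lp ℝ 2 (volume : Measure ℝ) :=
  MemLp.toLp (fun t => f (t - k))
    (hf.comp_measurePreserving (measurePreserving_sub_right volume (k : ℝ)))

theorem coeFn_translateLp {f : ℝ → ℝ} (hf : MemLp f 2 volume) (k : ℤ) :
    translateLp hf k =ᵐ[volume] fun t => f (t - k) :=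
  MemLp.coeFn_toLp _

theorem coeFn_sum_translateLp {f : ℝ → ℝ} (hf : MemLp f 2 volume) (s : Finset ℤ) (c : ℤ → ℝ) :
    (∑ k ∈ s, c k • translateLp hf k : Lp ℝ 2 (volume : Measure ℝ)) =ᵐ[volume]
      fun t => ∑ k ∈ s, c k * f (t - k) := by
  refine (Lp.coeFn_fun_finsetSum _ _).trans ?_
  have h1 := (eventually_all_finset s (l := ae (volume : Measure ℝ))).2
    fun k _ => Lp.coeFn_smul (c k) (translateLp hf k)
  have h2 := (eventually_all_finset s (l := ae (volume : Measure ℝ))).2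
    fun k _ => coeFn_translateLp hf k
  filter_upwards [h1, h2] with t h3 h4
  exact Finset.sum_congr rfl fun k hk => by
    rw [h3 k hk, Pi.smul_apply, h4 k hk, smul_eq_mul]

theorem enorm_sum_translate_sq {f : ℝ → ℝ} (hf : MemLp f 2 volume) (s : Finset ℤ) (c : ℤ → ℝ) :
    ‖∑ k ∈ s, c k • translateLp hf k‖ₑ ^ 2 =
      ∫⁻ ξ in Set.Ioc (0 : ℝ) 1, ‖trigPoly s c ξ‖ₑ ^ 2 * periodization hf ξ := by
  rw [Lp.enorm_def, eLpNorm_congr_ae (coeFn_sum_translateLp hf s c), eLpNorm_sum_translates_sq]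

/-- By Parseval, the unit vectors of ℓ² behave like translates with periodization identically 1, so
Riesz bounds become comparisons of weights. -/
theorem enorm_sum_unitVec_sq (s : Finset ℤ) (c : ℤ → ℝ) :
    ‖∑ k ∈ s, c k • unitVec k‖ₑ ^ 2 =
      ∫⁻ ξ in Set.Ioc (0 : ℝ) 1, ‖trigPoly s c ξ‖ₑ ^ 2 := by
  rw [lintegral_trigPoly, ← norm_sum_smul_unitVec_sq, ENNReal.ofReal_pow (norm_nonneg _),
    ofReal_norm]

theorem norm_le_mul_of_enorm_sq_le {E F : Type*} [NormedAddCommGroup E] [NormedAddCommGroup F]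
    {K : ℝ} (hK : 0 ≤ K) {x : E} {y : F} (h : ‖x‖ₑ ^ 2 ≤ ENNReal.ofReal K ^ 2 * ‖y‖ₑ ^ 2) :
    ‖x‖ ≤ K * ‖y‖ := by
  rw [← mul_pow, ← ofReal_norm, ← ofReal_norm, ← ENNReal.ofReal_mul hK] at h
  have h2 := (ENNReal.pow_le_pow_left_iff two_ne_zero).1 h
  exact (ENNReal.ofReal_le_ofReal_iff (by positivity)).1 h2

theorem lintegral_mul_le_const_mul {p q r : ℝ → ℝ≥0∞} {K : ℝ≥0∞} (hK : K ≠ ⊤)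
    (h : ∀ᵐ ξ, q ξ ≤ K * r ξ) :
    ∫⁻ ξ in Set.Ioc (0 : ℝ) 1, p ξ * q ξ ≤ K * ∫⁻ ξ in Set.Ioc (0 : ℝ) 1, p ξ * r ξ := by
  rw [← lintegral_const_mul' _ _ hK]
  refine lintegral_mono_ae (ae_restrict_of_ae (h.mono fun ξ hξ => ?_))
  calc p ξ * q ξ ≤ p ξ * (K * r ξ) := by gcongr
    _ = K * (p ξ * r ξ) := by ring

theorem ae_two_pi_mul {p : ℝ → Prop} (h : ∀ᵐ w, p w) : ∀ᵐ ξ : ℝ, p (2 * Real.pi * ξ) :=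
  (Measure.quasiMeasurePreserving_smul (volume : Measure ℝ)
    (by positivity : 2 * Real.pi ≠ 0)).ae h

/-- Comparison of the translates of two functions through their `G`-functions. -/
theorem familyDominated_translate {f g : ℝ → ℝ} (hf : MemLp f 2 volume) (hg : MemLp g 2 volume)
    {K : ℝ} (hK : 0 ≤ K) (h : ∀ᵐ w, gFun hf w ≤ ENNReal.ofReal K * gFun hg w) :
    FamilyDominated K (translateLp hf) (translateLp hg) := by
  intro s c
  refine norm_le_mul_of_enorm_sq_le hK ?_
  rw [enorm_sum_translate_sq, enorm_sum_translate_sq]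
  refine lintegral_mul_le_const_mul (ENNReal.pow_ne_top ENNReal.ofReal_ne_top) ?_
  filter_upwards [ae_two_pi_mul h] with ξ hξ
  rw [← gFun_sq, ← gFun_sq, ← mul_pow]
  exact pow_le_pow_left' hξ 2

/-- Upper Riesz bound. -/
theorem familyDominated_translate_unitVec {f : ℝ → ℝ} (hf : MemLp f 2 volume) {B : ℝ} (hB : 0 ≤ B)
    (h : ∀ᵐ w, gFun hf w ≤ ENNReal.ofReal B) : FamilyDominated B (translateLp hf) unitVec := by
  intro s c
  refine norm_le_mul_of_enorm_sq_le hB ?_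
  rw [enorm_sum_translate_sq, enorm_sum_unitVec_sq]
  have := lintegral_mul_le_const_mul (p := fun ξ => ‖trigPoly s c ξ‖ₑ ^ 2)
    (q := periodization hf) (r := fun _ => 1) (K := ENNReal.ofReal B ^ 2)
    (ENNReal.pow_ne_top ENNReal.ofReal_ne_top) ?_
  · simpa using this
  · filter_upwards [ae_two_pi_mul h] with ξ hξ
    rw [← gFun_sq, mul_one]
    exact pow_le_pow_left' hξ 2

/-- Lower Riesz bound. -/
theorem familyDominated_unitVec_translate {f : ℝ → ℝ} (hf : MemLp f 2 volume) {A : ℝ} (hA : 0 < A)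
    (h : ∀ᵐ w, ENNReal.ofReal A ≤ gFun hf w) : FamilyDominated A⁻¹ unitVec (translateLp hf) := by
  intro s c
  refine norm_le_mul_of_enorm_sq_le (inv_nonneg.2 hA.le) ?_
  rw [enorm_sum_translate_sq, enorm_sum_unitVec_sq]
  have := lintegral_mul_le_const_mul (p := fun ξ => ‖trigPoly s c ξ‖ₑ ^ 2)
    (q := fun _ => 1) (r := periodization hf) (K := ENNReal.ofReal A⁻¹ ^ 2)
    (ENNReal.pow_ne_top ENNReal.ofReal_ne_top) ?_
  · simpa using this
  · filter_upwards [ae_two_pi_mul h] with ξ hξ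
    rw [← gFun_sq, ← mul_pow, ENNReal.ofReal_inv_of_pos hA]
    refine one_le_pow₀ ?_
    rw [← ENNReal.inv_mul_cancel (ENNReal.ofReal_pos.2 hA).ne' ENNReal.ofReal_ne_top]
    gcongr

/-! ### The constant `τ` -/

/-- Apply the norm formula to a single translate, the one by 0. -/
theorem eq_zero_of_gFun_ae_eq_zero {f : ℝ → ℝ} (hf : MemLp f 2 volume)
    (h : ∀ᵐ w, gFun hf w = 0) : f =ᵐ[volume] 0 := by
  have h1 := enorm_sum_translate_sq hf {0} 1
  have h2 : ∫⁻ ξ in Set.Ioc (0 : ℝ) 1, ‖trigPoly {0} 1 ξ‖ₑ ^ 2 * periodization hf ξ = 0 := by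
    rw [← nonpos_iff_eq_zero, ← lintegral_zero (μ := volume.restrict (Set.Ioc (0 : ℝ) 1))]
    refine lintegral_mono_ae (ae_restrict_of_ae ?_)
    filter_upwards [ae_two_pi_mul h] with ξ hξ
    rw [← gFun_sq, hξ]; simp
  rw [h2] at h1
  have h3 : translateLp hf 0 = 0 := by simpa using h1
  have h4 := coeFn_translateLp hf 0
  rw [h3] at h4
  filter_upwards [h4, Lp.coeFn_zero ℝ 2 (volume : Measure ℝ)] with t h5 h6
  rw [h6] at h5
  simpa using h5.symm

/-- The derivative of a non-zero element of `H¹(ℝ)` is non-zero. -/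
theorem IsH1.eq_zero_of_deriv_eq_zero {f f' : ℝ → ℝ} (h : IsH1 f f') (h0 : f' =ᵐ[volume] 0) :
    f = 0 := by
  have hc : ∀ x, f x = f 0 := fun x => by
    have := h.sub_eq_integral 0 x
    rw [intervalIntegral.integral_zero_ae (h0.mono fun x hx _ => hx)] at this
    linarith
  have hf : f = fun _ => f 0 := funext hc
  have h2 := h.memLp
  rw [hf, memLp_const_iff two_ne_zero ENNReal.ofNat_ne_top] at h2
  ext x
  rw [hc]
  simpa using h2

/-- The essential infimum of G/G' is at least the reciprocal of the essential supremum of G'/G,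
hence positive. Once it is also known to be finite, the bound on G' is the inverse of G/G' ≥ τ/π. -/
theorem tau_pos_and_gFun_deriv_le {lam lam' : ℝ → ℝ} (hlam : IsH1 lam lam') {A B : ℝ} (hA : 0 < A)
    (hG : ∀ᵐ w ∂(volume : Measure ℝ),
      ENNReal.ofReal A ≤ gFun hlam.memLp w ∧ gFun hlam.memLp w ≤ ENNReal.ofReal B)
    (hG' : essSup (fun w => gFun hlam.memLp_deriv w / gFun hlam.memLp w) volume < ⊤) :
    0 < tau hlam ∧ ∀ᵐ w ∂(volume : Measure ℝ),
      gFun hlam.memLp_deriv w ≤ ENNReal.ofReal (Real.pi / tau hlam) * gFun hlam.memLp w := by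
  set G := gFun hlam.memLp
  set G' := gFun hlam.memLp_deriv
  set m := essInf (fun w => G w / G' w) volume with hm
  have hG0 : ∀ᵐ w, G w ≠ 0 ∧ G w ≠ ⊤ := hG.mono fun w hw =>
    ⟨((ENNReal.ofReal_pos.2 hA).trans_le hw.1).ne', (hw.2.trans_lt ENNReal.ofReal_lt_top).ne⟩
  have hinv : ∀ᵐ w, G w / G' w = (G' w / G w)⁻¹ := hG0.mono fun w hw => by
    rw [ENNReal.inv_div (Or.inl hw.2) (Or.inl hw.1)]
  have hm0 : m ≠ 0 := by
    refine ((ENNReal.inv_pos.2 hG'.ne).trans_le (le_essInf_of_ae_le _ ?_)).ne'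
    filter_upwards [hinv, ENNReal.ae_le_essSup fun w => G' w / G w] with w h1 h2
    rw [h1]
    exact ENNReal.inv_le_inv.2 h2
  have hle : ∀ᵐ w, m ≤ G w / G' w := ae_essInf_le
  -- An infinite value would be sent to 0 by `toReal`. It would force G' = 0, hence λ' = 0 and λ =
  -- 0, against the lower Riesz bound for one translate.
  have hmt : m ≠ ⊤ := by
    intro htop
    have h0 : ∀ᵐ w, G' w = 0 := by
      filter_upwards [hle, hG0] with w h1 h2
      rw [htop, top_le_iff, ENNReal.div_eq_top] at h1
      rcases h1 with h1 | h1
      · exact h1.2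
      · exact absurd h1.1 h2.2
    have h1 : lam = 0 :=
      hlam.eq_zero_of_deriv_eq_zero (eq_zero_of_gFun_ae_eq_zero hlam.memLp_deriv h0)
    have h2 := familyDominated_unitVec_translate hlam.memLp hA (hG.mono fun w hw => hw.1) {0} 1
    have h3 : translateLp hlam.memLp 0 = 0 := by
      rw [Lp.eq_zero_iff_ae_eq_zero]
      refine (coeFn_translateLp _ _).trans (ae_of_all _ fun t => ?_)
      simp [h1]
    have h4 : ‖unitVec 0‖ = 1 := by
      rw [unitVec, lp.norm_single (by norm_num)]; simp
    simp only [Finset.sum_singleton, Pi.one_apply, one_smul, h3, h4, norm_zero, mul_zero] at h2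
    linarith
  have hmr : 0 < m.toReal := ENNReal.toReal_pos hm0 hmt
  have htau : tau hlam = Real.pi * m.toReal := rfl
  refine ⟨by rw [htau]; positivity, ?_⟩
  have hK : ENNReal.ofReal (Real.pi / tau hlam) = m⁻¹ := by
    rw [htau, div_mul_cancel_left₀ Real.pi_pos.ne', ENNReal.ofReal_inv_of_pos hmr,
      ENNReal.ofReal_toReal hmt]
  filter_upwards [hle, hinv, hG0] with w h1 h2 h3
  rw [hK, ← ENNReal.div_le_iff h3.1 h3.2, ← inv_inv (G' w / G w), ← h2]
  exact ENNReal.inv_le_inv.2 h1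

/-! ### Part: point values in H¹(ℝ) and ℓ² series of translates. -/

theorem enorm_sub_le_of_sub_eq_integral {f f' : ℝ → ℝ} (hf : ∀ a b, f b - f a = ∫ x in a..b, f' x)
    {a b : ℝ} (hab : a ≤ b) : ‖f b - f a‖ₑ ≤ ∫⁻ x in Set.Ioc a b, ‖f' x‖ₑ := by
  rw [hf, intervalIntegral.integral_of_le hab]
  exact enorm_integral_le_lintegral_enorm _

/-- An element of `H¹(ℝ)` is controlled at a point by its norm on the preceding unit interval. -/
theorem IsH1.enorm_sq_le {f f' : ℝ → ℝ} (h : IsH1 f f') (t : ℝ) :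
    ‖f t‖ₑ ^ 2 ≤ ∫⁻ x in Set.Ioc (t - 1) t, (‖f x‖ₑ + ‖f' x‖ₑ) ^ 2 := by
  have hfm : AEMeasurable (fun x => ‖f x‖ₑ) := h.memLp.1.enorm
  have hfm' : AEMeasurable (fun x => ‖f' x‖ₑ) := h.memLp_deriv.1.enorm
  have hvol : volume (Set.Ioc (t - 1) t) = 1 := by simp
  have h1 : ∀ x ∈ Set.Ioc (t - 1) t, ‖f t‖ₑ ≤ ‖f x‖ₑ + ∫⁻ y in Set.Ioc (t - 1) t, ‖f' y‖ₑ := by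
    intro x hx
    calc ‖f t‖ₑ = ‖f x + (f t - f x)‖ₑ := by rw [add_sub_cancel]
      _ ≤ ‖f x‖ₑ + ‖f t - f x‖ₑ := enorm_add_le _ _
      _ ≤ _ := by
        gcongr
        exact (enorm_sub_le_of_sub_eq_integral h.sub_eq_integral hx.2).trans
          (lintegral_mono_set (Set.Ioc_subset_Ioc_left hx.1.le))
  -- Average the previous bound over x in the interval, which has length 1.
  have h2 : ‖f t‖ₑ ≤ ∫⁻ x in Set.Ioc (t - 1) t, (‖f x‖ₑ + ‖f' x‖ₑ) := by
    calc ‖f t‖ₑ = ∫⁻ _ in Set.Ioc (t - 1) t, ‖f t‖ₑ := by rw [setLIntegral_const, hvol, mul_one]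
      _ ≤ ∫⁻ x in Set.Ioc (t - 1) t, (‖f x‖ₑ + ∫⁻ y in Set.Ioc (t - 1) t, ‖f' y‖ₑ) :=
        setLIntegral_mono' measurableSet_Ioc h1
      _ = _ := by
        rw [lintegral_add_left' hfm.restrict, lintegral_add_left' hfm.restrict,
          setLIntegral_const, hvol, mul_one]
  refine (pow_le_pow_left' h2 2).trans ((lintegral_sq_le_lintegral_mul_lintegral_div _
    (hfm.add hfm').restrict (aemeasurable_const (b := 1)) (ae_of_all _ fun _ => one_ne_zero)
    (ae_of_all _ fun _ => ENNReal.one_ne_top)).trans_eq ?_)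
  simp [hvol]

/-- The unit intervals ending at the points t + n tile the line, so the local bounds add up to a
single finite L² integral. -/
theorem IsH1.summable_sq_translates {f f' : ℝ → ℝ} (h : IsH1 f f') (t : ℝ) :
    Summable fun k : ℤ => f (t - k) ^ 2 := by
  have hm : MemLp (fun x => ‖f x‖ + ‖f' x‖) 2 volume := h.memLp.norm.add h.memLp_deriv.norm
  have hfin : ∑' n : ℤ, ‖f (t + n)‖ₑ ^ 2 ≠ ⊤ := by
    have h1 : ∑' n : ℤ, ‖f (t + n)‖ₑ ^ 2 ≤ ∫⁻ x, (‖f x‖ₑ + ‖f' x‖ₑ) ^ 2 := by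
      rw [← setLIntegral_univ, ← iUnion_Ioc_add_intCast (t - 1),
        lintegral_iUnion (fun n => measurableSet_Ioc) (Set.pairwise_disjoint_Ioc_add_intCast _)]
      refine ENNReal.tsum_le_tsum fun n => ?_
      have := h.enorm_sq_le (t - 1 + n + 1)
      rw [show t + (n : ℝ) = t - 1 + n + 1 by ring]
      rwa [add_sub_cancel_right] at this
    have h2 := (eLpNorm_lt_top_iff_lintegral_rpow_enorm_lt_top two_ne_zero
      ENNReal.ofNat_ne_top).1 hm.2
    refine (h1.trans_lt (lt_of_le_of_lt (lintegral_mono fun x => ?_) h2)).ne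
    rw [ENNReal.toReal_ofNat, ENNReal.rpow_two, ← ofReal_norm, ← ofReal_norm, ← ofReal_norm,
      ← ENNReal.ofReal_add (norm_nonneg _) (norm_nonneg _),
      Real.norm_of_nonneg (by positivity : 0 ≤ ‖f x‖ + ‖f' x‖)]
  have h3 : Summable fun n : ℤ => f (t + n) ^ 2 := by
    refine (ENNReal.summable_toReal hfin).congr fun n => ?_
    simp
  exact ((Equiv.neg ℤ).summable_iff.2 h3).congr fun k => by simp [sub_eq_add_neg]

theorem IsH1.summable_mul_translates {f f' : ℝ → ℝ} (h : IsH1 f f') (c : lp (fun _ : ℤ => ℝ) 2)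
    (t : ℝ) : Summable fun k : ℤ => c k * f (t - k) := by
  have h1 : Summable fun k : ℤ => c k ^ 2 := by
    simpa using (lp.memℓp c).summable (by norm_num)
  refine Summable.of_norm_bounded (h1.add (h.summable_sq_translates t)) fun k => ?_
  rw [Real.norm_eq_abs, abs_mul]
  nlinarith [sq_nonneg (|c k| - |f (t - k)|), sq_abs (c k), sq_abs (f (t - k)), sq_nonneg (c k),
    sq_nonneg (f (t - k))]

/-- The `L²` sum and the pointwise sum of a series of translates agree. -/
theorem ae_eq_of_hasSum_translateLp {f : ℝ → ℝ} (hf : MemLp f 2 volume) {c : ℤ → ℝ}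
    {F : Lp ℝ 2 (volume : Measure ℝ)} {g : ℝ → ℝ}
    (hF : HasSum (fun k => c k • translateLp hf k) F)
    (hg : ∀ t, HasSum (fun k : ℤ => c k * f (t - k)) (g t)) : F =ᵐ[volume] g := by
  have h1 : Tendsto (fun s : Finset ℤ => ∑ k ∈ s, c k • translateLp hf k) atTop (𝓝 F) := hF
  -- L² convergence gives almost everywhere convergence only along a subsequence of finite sets;
  -- those sets still exhaust ℤ, so the pointwise sum has the same limit.
  obtain ⟨ns, hns, hae⟩ := (tendstoInMeasure_of_tendsto_Lp h1).exists_seq_tendsto_ae'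
  have h2 : ∀ᵐ t, ∀ i : ℕ, (∑ k ∈ ns i, c k • translateLp hf k : Lp ℝ 2 (volume : Measure ℝ)) t =
      ∑ k ∈ ns i, c k * f (t - k) :=
    ae_all_iff.2 fun i => coeFn_sum_translateLp hf (ns i) c
  filter_upwards [hae, h2] with t h3 h4
  have h5 : Tendsto (fun s : Finset ℤ => ∑ k ∈ s, c k * f (t - k)) atTop (𝓝 (g t)) := hg t
  exact tendsto_nhds_unique (h3.congr h4) (h5.comp hns)

open scoped RealInnerProductSpace in
/-- A series of translates can be differentiated term by term. -/
theorem sub_eq_integral_of_hasSum {f f' : ℝ → ℝ} (hf' : MemLp f' 2 volume)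
    (hf : ∀ a b, f b - f a = ∫ x in a..b, f' x) {c : ℤ → ℝ}
    {F : Lp ℝ 2 (volume : Measure ℝ)} {g : ℝ → ℝ}
    (hF : HasSum (fun k => c k • translateLp hf' k) F)
    (hg : ∀ t, HasSum (fun k : ℤ => c k * f (t - k)) (g t)) (a b : ℝ) :
    g b - g a = ∫ x in a..b, F x := by
  wlog hab : a ≤ b generalizing a b
  · rw [intervalIntegral.integral_symm, ← this b a (not_le.1 hab).le, neg_sub]
  -- Integration over (a, b] is the inner product with this indicator, hence continuous on L² and
  -- compatible with the series.
  set u := indicatorConstLp 2 (measurableSet_Ioc (a := a) (b := b))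
    (measure_Ioc_lt_top (μ := volume)).ne (1 : ℝ)
  have hu : ∀ G : Lp ℝ 2 (volume : Measure ℝ), ⟪u, G⟫ = ∫ x in a..b, G x := fun G => by
    rw [intervalIntegral.integral_of_le hab]
    exact L2.inner_indicatorConstLp_one _ _ G
  have h1 : HasSum (fun k => ⟪u, c k • translateLp hf' k⟫) ⟪u, F⟫ := hF.mapL (innerSL ℝ u)
  have h2 : ∀ k, ⟪u, c k • translateLp hf' k⟫ = c k * f (b - k) - c k * f (a - k) := by
    intro k
    rw [real_inner_smul_right, hu, intervalIntegral.integral_congr_ae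
      ((coeFn_translateLp hf' k).mono fun x hx _ => hx),
      intervalIntegral.integral_comp_sub_right, ← hf, mul_sub]
  simp_rw [h2, hu] at h1
  exact ((hg b).sub (hg a)).unique h1

/-- A space of `ℓ²` combinations of a Riesz sequence is closed. -/
theorem isClosed_range_of_riesz {H : Type*} [NormedAddCommGroup H] [NormedSpace ℝ H]
    [CompleteSpace H] {v : ℤ → H} {B C : ℝ} (hB : 0 ≤ B) (hC : 0 ≤ C)
    (hv : FamilyDominated B v unitVec) (hv' : FamilyDominated C unitVec v) :
    IsClosed {x : H | ∃ c : lp (fun _ : ℤ => ℝ) 2, HasSum (fun k => c k • v k) x} := by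
  have hs : ∀ c : lp (fun _ : ℤ => ℝ) 2, HasSum (fun k => c k • v k) (∑' k, c k • v k) :=
    fun c => (hv.summable hB (hasSum_smul_unitVec c).summable).hasSum
  let S : lp (fun _ : ℤ => ℝ) 2 →ₗ[ℝ] H :=
    { toFun := fun c => ∑' k, c k • v k
      map_add' := fun c d => by
        refine HasSum.tsum_eq (((hs c).add (hs d)).congr_fun fun k => ?_)
        simp [add_smul]
      map_smul' := fun a c => by
        refine HasSum.tsum_eq (((hs c).const_smul a).congr_fun fun k => ?_)
        simp [mul_smul] }
  let S' := S.mkContinuous B fun c => hv.norm_le (hasSum_smul_unitVec c) (hs c)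
  -- The lower Riesz bound makes the synthesis map bounded below; as ℓ² is complete, its range is
  -- closed.
  have hS : AntilipschitzWith ⟨C, hC⟩ S' := by
    refine AddMonoidHomClass.antilipschitz_of_bound S' fun c => ?_
    exact hv'.norm_le (hs c) (hasSum_smul_unitVec c)
  have : {x : H | ∃ c : lp (fun _ : ℤ => ℝ) 2, HasSum (fun k => c k • v k) x} = Set.range S' := by
    ext x
    exact ⟨fun ⟨c, hc⟩ => ⟨c, hc.tsum_eq⟩, fun ⟨c, hc⟩ => ⟨c, hc ▸ hs c⟩⟩
  rw [this]
  exact hS.isClosed_range S'.uniformContinuous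

/-- The functions in `V²(λ)`, their derivatives, and the resulting Bernstein inequality. -/
theorem IsH1.exists_deriv_of_mem_V2 {lam lam' : ℝ → ℝ} (h : IsH1 lam lam') {B K : ℝ} (hB : 0 ≤ B)
    (hK : 0 ≤ K) (hv : FamilyDominated B (translateLp h.memLp) unitVec)
    (hd : FamilyDominated K (translateLp h.memLp_deriv) (translateLp h.memLp))
    {g : ℝ → ℝ} (hg : g ∈ V2 lam) :
    MemLp g 2 volume ∧ ∃ G : Lp ℝ 2 (volume : Measure ℝ),
      (∀ a b, g b - g a = ∫ x in a..b, G x) ∧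
      eLpNorm G 2 volume ≤ ENNReal.ofReal K * eLpNorm g 2 volume := by
  obtain ⟨c, hc⟩ := hg
  have h1 := (hv.summable hB (hasSum_smul_unitVec c).summable).hasSum
  have h2 := (hd.summable hK h1.summable).hasSum
  have hae := ae_eq_of_hasSum_translateLp h.memLp h1 hc
  refine ⟨(memLp_congr_ae hae).1 (Lp.memLp _), _,
    sub_eq_integral_of_hasSum h.memLp_deriv h.sub_eq_integral h2 hc, ?_⟩
  rw [← eLpNorm_congr_ae hae, ← Lp.enorm_def, ← Lp.enorm_def, ← ofReal_norm, ← ofReal_norm,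
    ← ENNReal.ofReal_mul hK]
  exact ENNReal.ofReal_le_ofReal (hd.norm_le h1 h2)

theorem continuous_of_sub_eq_integral {g : ℝ → ℝ} {G : Lp ℝ 2 (volume : Measure ℝ)}
    (h : ∀ a b, g b - g a = ∫ x in a..b, G x) : Continuous g := by
  have hG : LocallyIntegrable G := (Lp.memLp G).locallyIntegrable one_le_two
  have h0 : g = fun x => g 0 + ∫ y in (0 : ℝ)..x, G y := by
    ext x; rw [← h]; ring
  rw [h0]
  refine continuous_const.add (intervalIntegral.continuous_primitive (fun a b => ?_) 0)
  exact (hG.integrableOn_isCompact isCompact_uIcc).intervalIntegrable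

theorem IsH1.isClosed_V2L2 {lam lam' : ℝ → ℝ} (h : IsH1 lam lam') {B C : ℝ} (hB : 0 ≤ B)
    (hC : 0 ≤ C) (hv : FamilyDominated B (translateLp h.memLp) unitVec)
    (hv' : FamilyDominated C unitVec (translateLp h.memLp)) :
    IsClosed (V2L2 lam : Set (Lp ℝ 2 (volume : Measure ℝ))) := by
  convert isClosed_range_of_riesz hB hC hv hv' using 1
  ext F
  constructor
  · rintro ⟨f, ⟨c, hc⟩, hF⟩
    have h1 := (hv.summable hB (hasSum_smul_unitVec c).summable).hasSum
    have : F = ∑' k, c k • translateLp h.memLp k :=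
      Lp.ext (hF.trans (ae_eq_of_hasSum_translateLp h.memLp h1 hc).symm)
    exact ⟨c, this ▸ h1⟩
  · rintro ⟨c, hc⟩
    have h1 : ∀ t, HasSum (fun k : ℤ => c k * lam (t - k)) (∑' k : ℤ, c k * lam (t - k)) :=
      fun t => (h.summable_mul_translates c t).hasSum
    exact ⟨_, ⟨c, h1⟩, ae_eq_of_hasSum_translateLp h.memLp hc h1⟩

/-! ### Wirtinger's inequality on the Voronoi cells -/

/-- Wirtinger's inequality for functions vanishing at the left end point. -/
theorem lintegral_sq_sub_left_le {T L : ℝ} (hT : 0 < T) (hL : L ≤ T / 2) {g G : ℝ → ℝ}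
    (hG : Measurable G) (hg : ∀ a b, g b - g a = ∫ x in a..b, G x) (t : ℝ) :
    ∫⁻ x in Set.Ioo t (t + L), ‖g x - g t‖ₑ ^ 2 ≤
      ENNReal.ofReal ((T / Real.pi) ^ 2) * ∫⁻ x in Set.Ioo t (t + L), ‖G x‖ₑ ^ 2 := by
  have hmp : MeasurePreserving (fun x : ℝ => x + t) volume volume :=
    measurePreserving_add_right volume t
  have hshift : ∀ (h : ℝ → ℝ≥0∞) (L : ℝ), ∫⁻ x in Set.Ioo t (t + L), h x =
      ∫⁻ x in Set.Ioo 0 L, h (x + t) := fun h L => by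
    rw [← hmp.setLIntegral_comp_preimage_emb (measurableEmbedding_addRight t)]
    congr 2
    ext x
    simp only [Set.mem_preimage, Set.mem_Ioo]
    constructor <;> rintro ⟨h1, h2⟩ <;> constructor <;> linarith
  rw [hshift, hshift]
  refine (setLIntegral_mono' measurableSet_Ioo fun x hx => ?_).trans
    (lintegral_sq_volterra_le hT hL (h := fun y => ‖G (y + t)‖ₑ) (by fun_prop))
  refine pow_le_pow_left' ((enorm_sub_le_of_sub_eq_integral hg (by linarith [hx.1])).trans_eq ?_) 2
  rw [setLIntegral_congr Ioo_ae_eq_Ioc.symm, add_comm x t, hshift fun y => ‖G y‖ₑ]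

/-- Wirtinger's inequality for functions vanishing at the right end point. -/
theorem lintegral_sq_sub_right_le {T L : ℝ} (hT : 0 < T) (hL : L ≤ T / 2) {g G : ℝ → ℝ}
    (hG : Measurable G) (hg : ∀ a b, g b - g a = ∫ x in a..b, G x) (t : ℝ) :
    ∫⁻ x in Set.Ioo (t - L) t, ‖g x - g t‖ₑ ^ 2 ≤
      ENNReal.ofReal ((T / Real.pi) ^ 2) * ∫⁻ x in Set.Ioo (t - L) t, ‖G x‖ₑ ^ 2 := by
  have hmp : MeasurePreserving (fun x : ℝ => -x) volume volume :=
    Measure.measurePreserving_neg volume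
  have hrefl : ∀ (h : ℝ → ℝ≥0∞), ∫⁻ x in Set.Ioo (t - L) t, h x =
      ∫⁻ x in Set.Ioo (-t) (-t + L), h (-x) := fun h => by
    rw [← hmp.setLIntegral_comp_preimage_emb (MeasurableEquiv.neg ℝ).measurableEmbedding]
    congr 2
    ext x
    simp only [Set.mem_preimage, Set.mem_Ioo]
    constructor <;> rintro ⟨h1, h2⟩ <;> constructor <;> linarith
  rw [hrefl, hrefl]
  -- Reflection x ↦ -x exchanges the end points; the derivative changes sign, which the norms
  -- ignore.
  have := lintegral_sq_sub_left_le hT hL (g := fun x => g (-x)) (G := fun x => -G (-x))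
    (by fun_prop) (fun a b => by
      rw [intervalIntegral.integral_neg, intervalIntegral.integral_comp_neg, hg,
        intervalIntegral.integral_symm]) (-t)
  simpa using this

/-- Wirtinger's inequality on an interval containing the node `t`, the end points of which are at
distance at most `T / 2` from `t`. -/
theorem lintegral_sq_sub_le {T t a b : ℝ} (hT : 0 < T) (hat : a ≤ t) (htb : t ≤ b)
    (ha : t - a ≤ T / 2) (hb : b - t ≤ T / 2) {g G : ℝ → ℝ}
    (hG : Measurable G) (hg : ∀ a b, g b - g a = ∫ x in a..b, G x) :
    ∫⁻ x in Set.Ico a b, ‖g x - g t‖ₑ ^ 2 ≤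
      ENNReal.ofReal ((T / Real.pi) ^ 2) * ∫⁻ x in Set.Ico a b, ‖G x‖ₑ ^ 2 := by
  have hsplit : ∀ h : ℝ → ℝ≥0∞, ∫⁻ x in Set.Ico a b, h x =
      (∫⁻ x in Set.Ioo a t, h x) + ∫⁻ x in Set.Ioo t b, h x := fun h => by
    rw [← Set.Ico_union_Ico_eq_Ico hat htb,
      lintegral_union measurableSet_Ico (Set.Ico_disjoint_Ico_same),
      setLIntegral_congr Ioo_ae_eq_Ico, setLIntegral_congr Ioo_ae_eq_Ico]
  rw [hsplit, hsplit, mul_add]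
  have h1 := lintegral_sq_sub_right_le hT ha hG hg t
  have h2 := lintegral_sq_sub_left_le hT hb hG hg t
  rw [sub_sub_cancel] at h1
  rw [add_sub_cancel] at h2
  exact add_le_add h1 h2

/-! ### Voronoi cells -/

/-- The intervals between consecutive terms of a sequence tending to `±∞` cover the line. -/
theorem exists_mem_Ico_of_tendsto {s : ℤ → ℝ} (htop : Tendsto s atTop atTop)
    (hbot : Tendsto s atBot atBot) (hs : StrictMono s) (x : ℝ) :
    ∃ n, x ∈ Set.Ico (s n) (s (n + 1)) := by
  obtain ⟨N, hN⟩ := (htop.eventually_gt_atTop x).exists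
  obtain ⟨m, hm⟩ := (hbot.eventually_le_atBot x).exists
  obtain ⟨n, hn, hmax⟩ := Int.exists_greatest_of_bdd (P := fun n => s n ≤ x)
    ⟨N, fun z hz => (hs.lt_iff_lt.1 (hz.trans_lt hN)).le⟩ ⟨m, hm⟩
  refine ⟨n, hn, not_le.1 fun h => ?_⟩
  have := hmax _ h
  omega

/-- The left end point of the `n`-th Voronoi cell. -/
noncomputable def cellLeft (t : ℤ → ℝ) (n : ℤ) : ℝ := (t (n - 1) + t n) / 2

/-- The `n`-th Voronoi cell. -/
def cell (t : ℤ → ℝ) (n : ℤ) : Set ℝ := Set.Ico (cellLeft t n) (cellLeft t (n + 1))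

section Cells

variable {t : ℤ → ℝ}

theorem strictMono_cellLeft (ht : StrictMono t) : StrictMono (cellLeft t) := fun m n h => by
  have h1 := ht (sub_lt_sub_right h 1)
  have h2 := ht h
  unfold cellLeft
  linarith

theorem cellLeft_le (ht : StrictMono t) (n : ℤ) : cellLeft t n ≤ t n := by
  have := ht (sub_one_lt n)
  unfold cellLeft
  linarith

theorem le_cellLeft (ht : StrictMono t) (n : ℤ) : t (n - 1) ≤ cellLeft t n := by
  have := ht (sub_one_lt n)
  unfold cellLeft
  linarith

theorem exists_mem_cell (ht : StrictMono t) (htop : Tendsto t atTop atTop)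
    (hbot : Tendsto t atBot atBot) (x : ℝ) : ∃ n, x ∈ cell t n := by
  refine exists_mem_Ico_of_tendsto ?_ ?_ (strictMono_cellLeft ht) x
  · exact tendsto_atTop_mono (le_cellLeft ht)
      (htop.comp (tendsto_atTop_add_const_right _ (-1) tendsto_id))
  · exact tendsto_atBot_mono (cellLeft_le ht) hbot

theorem pairwise_disjoint_cell (ht : StrictMono t) :
    Pairwise (Function.onFun Disjoint (cell t)) :=
  (strictMono_cellLeft ht).monotone.pairwise_disjoint_on_Ico_succ

theorem measurableSet_cell (n : ℤ) : MeasurableSet (cell t n) := measurableSet_Ico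

theorem lintegral_eq_tsum_cell (ht : StrictMono t) (htop : Tendsto t atTop atTop)
    (hbot : Tendsto t atBot atBot) (h : ℝ → ℝ≥0∞) :
    ∫⁻ x, h x = ∑' n, ∫⁻ x in cell t n, h x := by
  rw [← lintegral_iUnion measurableSet_cell (pairwise_disjoint_cell ht),
    Set.eq_univ_of_forall fun x => Set.mem_iUnion.2 (exists_mem_cell ht htop hbot x),
    setLIntegral_univ]

theorem voronoiStep_eq (ht : StrictMono t) (a : ℤ → ℝ) {n : ℤ} {x : ℝ} (hx : x ∈ cell t n) :
    voronoiStep t a x = a n := by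
  have h : voronoiStep t a x = ∑' n, (cell t n).indicator (fun _ => a n) x := by
    simp only [voronoiStep, cell, cellLeft, add_sub_cancel_right]
  rw [h, tsum_eq_single n, Set.indicator_of_mem hx]
  intro m hm
  exact Set.indicator_of_notMem
    (fun h => Set.disjoint_left.1 (pairwise_disjoint_cell ht hm) h hx) _

theorem measurable_voronoiStep (ht : StrictMono t) (htop : Tendsto t atTop atTop)
    (hbot : Tendsto t atBot atBot) (a : ℤ → ℝ) : Measurable (voronoiStep t a) := by
  intro s _
  have : voronoiStep t a ⁻¹' s = ⋃ n ∈ {n | a n ∈ s}, cell t n := by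
    ext x
    obtain ⟨n, hn⟩ := exists_mem_cell ht htop hbot x
    simp only [Set.mem_preimage, Set.mem_iUnion, exists_prop]
    refine ⟨fun h => ⟨n, by rwa [voronoiStep_eq ht a hn] at h, hn⟩, fun ⟨m, hm, hx⟩ => ?_⟩
    rw [voronoiStep_eq ht a hx]
    exact hm
  rw [this]
  exact MeasurableSet.biUnion (Set.to_countable _) fun n _ => measurableSet_cell n

theorem voronoiOp_sub (ht : StrictMono t) (htop : Tendsto t atTop atTop)
    (hbot : Tendsto t atBot atBot) (f g : ℝ → ℝ) :
    voronoiOp t (f - g) = voronoiOp t f - voronoiOp t g := by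
  ext x
  obtain ⟨n, hn⟩ := exists_mem_cell ht htop hbot x
  simp only [voronoiOp, Pi.sub_apply]
  rw [voronoiStep_eq ht _ hn, voronoiStep_eq ht _ hn, voronoiStep_eq ht _ hn]

/-- The Voronoi approximation error is controlled by the derivative. -/
theorem eLpNorm_sub_voronoiOp_le {T : ℝ} (hT : 0 < T) (ht : StrictMono t)
    (htop : Tendsto t atTop atTop) (hbot : Tendsto t atBot atBot)
    (hgap : ∀ n, t (n + 1) - t n ≤ T) {g G : ℝ → ℝ} (hG : Measurable G)
    (hg : ∀ a b, g b - g a = ∫ x in a..b, G x) :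
    eLpNorm (g - voronoiOp t g) 2 volume ≤ ENNReal.ofReal (T / Real.pi) * eLpNorm G 2 volume := by
  have hsq : ∀ u : ℝ → ℝ, eLpNorm u 2 volume ^ 2 = ∫⁻ ξ, ‖u ξ‖ₑ ^ 2 := fun u => by
    have := eLpNorm_nnreal_pow_eq_lintegral (f := u) (μ := volume) (p := 2) two_ne_zero
    simpa using this
  rw [← ENNReal.pow_le_pow_left_iff two_ne_zero, mul_pow, hsq, hsq,
    ← ENNReal.ofReal_pow (by positivity), lintegral_eq_tsum_cell ht htop hbot,
    lintegral_eq_tsum_cell ht htop hbot, ← ENNReal.tsum_mul_left]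
  refine ENNReal.tsum_le_tsum fun n => ?_
  have h1 : ∫⁻ x in cell t n, ‖(g - voronoiOp t g) x‖ₑ ^ 2 =
      ∫⁻ x in cell t n, ‖g x - g (t n)‖ₑ ^ 2 :=
    setLIntegral_congr_fun (measurableSet_cell n) fun x hx => by
      simp only [Pi.sub_apply, voronoiOp]
      rw [voronoiStep_eq ht _ hx]
  rw [h1]
  -- Cell ends are midpoints between neighbouring nodes: gap n bounds the right half of the cell and
  -- gap n - 1 the left half, each by T/2.
  have h2 := hgap n
  have h3 := hgap (n - 1)
  have h4 := le_cellLeft ht (n + 1)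
  rw [sub_add_cancel] at h3
  rw [add_sub_cancel_right] at h4
  refine lintegral_sq_sub_le hT (cellLeft_le ht n) h4 ?_ ?_ hG hg
  · unfold cellLeft; linarith
  · unfold cellLeft; rw [add_sub_cancel_right]; linarith

end Cells

/-! ### The projector and the iteration -/

/-- Closedness puts the projection in V²(λ) itself, so a representative exists and the ε-choice
returns one. -/
theorem isProjOf_projV2 {lam h : ℝ → ℝ}
    (hcl : IsClosed (V2L2 lam : Set (Lp ℝ 2 (volume : Measure ℝ)))) (hh : MemLp h 2 volume) :
    projV2 lam h ∈ V2 lam ∧ projL2 lam (hh.toLp h) =ᵐ[volume] projV2 lam h := by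
  have hmem : projL2 lam (hh.toLp h) ∈ V2L2 lam :=
    hcl.submodule_topologicalClosure_eq.le (Submodule.starProjection_apply_mem _ _)
  obtain ⟨g, hg, hae⟩ := hmem
  have hex : ∃ g, IsProjOf lam h g := ⟨g, hg, hh, hae⟩
  obtain ⟨h1, _, h2⟩ := Classical.epsilon_spec hex
  exact ⟨h1, h2⟩

/-- Since Pg = g, the difference on the left is P(g - h), and an orthogonal projector does not
increase norms. -/
theorem eLpNorm_sub_projV2_le {lam g h : ℝ → ℝ}
    (hcl : IsClosed (V2L2 lam : Set (Lp ℝ 2 (volume : Measure ℝ)))) (hg : g ∈ V2 lam)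
    (hgm : MemLp g 2 volume) (hh : MemLp h 2 volume) :
    eLpNorm (g - projV2 lam h) 2 volume ≤ eLpNorm (g - h) 2 volume := by
  have h1 : projL2 lam (hgm.toLp g) = hgm.toLp g :=
    Submodule.starProjection_eq_self_iff.2
      ((V2L2 lam).le_topologicalClosure ⟨g, hg, hgm.coeFn_toLp⟩)
  have h2 : projL2 lam ((hgm.sub hh).toLp (g - h)) =ᵐ[volume] g - projV2 lam h := by
    rw [MemLp.toLp_sub hgm hh, map_sub, h1]
    exact (Lp.coeFn_sub _ _).trans (hgm.coeFn_toLp.sub (isProjOf_projV2 hcl hh).2)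
  rw [← eLpNorm_congr_ae h2, ← eLpNorm_congr_ae (hgm.sub hh).coeFn_toLp, ← Lp.enorm_def,
    ← Lp.enorm_def, ← ofReal_norm, ← ofReal_norm]
  exact ENNReal.ofReal_le_ofReal (Submodule.norm_starProjection_apply_le _ _)

theorem projV2_sub_ae {lam g h : ℝ → ℝ}
    (hcl : IsClosed (V2L2 lam : Set (Lp ℝ 2 (volume : Measure ℝ)))) (hg : MemLp g 2 volume)
    (hh : MemLp h 2 volume) :
    projV2 lam (g - h) =ᵐ[volume] projV2 lam g - projV2 lam h := by
  refine (isProjOf_projV2 hcl (hg.sub hh)).2.symm.trans ?_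
  rw [MemLp.toLp_sub hg hh, map_sub]
  exact (Lp.coeFn_sub _ _).trans ((isProjOf_projV2 hcl hg).2.sub (isProjOf_projV2 hcl hh).2)

/-- Geometric convergence of the iteration, for a contraction `Id - P V`. -/
theorem recon_mem_and_eLpNorm_le {lam : ℝ → ℝ} {t : ℤ → ℝ} {r : ℝ} (hr : 0 ≤ r)
    (hmem : ∀ g ∈ V2 lam, opPV lam t g ∈ V2 lam)
    (hsub : ∀ g ∈ V2 lam, ∀ h ∈ V2 lam,
      opPV lam t (g - h) =ᵐ[volume] opPV lam t g - opPV lam t h)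
    (hcontr : ∀ g ∈ V2 lam,
      eLpNorm (g - opPV lam t g) 2 volume ≤ ENNReal.ofReal r * eLpNorm g 2 volume)
    {f : ℝ → ℝ} (hf : f ∈ V2 lam) (k : ℕ) :
    recon lam t f k ∈ V2 lam ∧
      eLpNorm (f - recon lam t f k) 2 volume ≤ ENNReal.ofReal (r ^ k) * eLpNorm f 2 volume := by
  induction k using Nat.twoStepInduction with
  | zero => exact ⟨hf, by simp [recon]⟩
  | one => exact ⟨hmem f hf, by simpa [recon] using hcontr f hf⟩
  | more k _ ih =>
    obtain ⟨h1, h2⟩ := ih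
    set u := recon lam t f (k + 1) with hu
    have hrec : recon lam t f (k + 2) = opPV lam t f + (u - opPV lam t u) := rfl
    refine ⟨?_, ?_⟩
    · rw [hrec]
      exact (V2 lam).add_mem (hmem f hf) ((V2 lam).sub_mem h1 (hmem u h1))
    · have hae : f - recon lam t f (k + 2) =ᵐ[volume] (f - u) - opPV lam t (f - u) := by
        filter_upwards [hsub f hf u h1] with x hx
        simp only [hrec, Pi.sub_apply, Pi.add_apply] at hx ⊢
        rw [hx]; ring
      rw [eLpNorm_congr_ae hae]
      refine (hcontr _ ((V2 lam).sub_mem hf h1)).trans ?_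
      calc ENNReal.ofReal r * eLpNorm (f - u) 2 volume
          ≤ ENNReal.ofReal r * (ENNReal.ofReal (r ^ (k + 1)) * eLpNorm f 2 volume) := by gcongr
        _ = ENNReal.ofReal (r ^ (k + 2)) * eLpNorm f 2 volume := by
          rw [← mul_assoc, ← ENNReal.ofReal_mul hr]
          congr 2; ring

/-! ### Part: decoding and the main theorem. -/

/-- Nonemptiness of `E` supplies a value of the decoder at sequences that are not outputs. -/
theorem TEM.isInvertible_of_injective {E : Set (ℝ → ℝ)} (hE : E.Nonempty) (M : TEM E)
    (h : ∀ f g : E, M.times f = M.times g → f = g) : M.IsInvertible := by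
  classical
  have : Nonempty E := hE.to_subtype
  refine ⟨fun s => Function.invFun M.times s.1, fun f => ?_⟩
  exact Function.leftInverse_invFun (fun f g => h f g) f

theorem theorem1 (lam lam' : ℝ → ℝ) (hlam : IsH1 lam lam') (A B : ℝ) (hA : 0 < A)
    (hG : ∀ᵐ w ∂(volume : Measure ℝ),
      ENNReal.ofReal A ≤ gFun hlam.memLp w ∧ gFun hlam.memLp w ≤ ENNReal.ofReal B)
    (hG' : essSup (fun w => gFun hlam.memLp_deriv w / gFun hlam.memLp w) volume < ⊤) :
    0 < tau hlam ∧
    (∀ f ∈ V2 lam, Continuous f ∧ MemLp f 2 volume) ∧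
    IsClosed (V2L2 lam : Set (Lp ℝ 2 (volume : Measure ℝ))) ∧
    ∀ T : ℝ, T < tau hlam →
      ∀ E : Set (ℝ → ℝ), E.Nonempty → E ⊆ V2 lam →
      ∀ (M : TEM E) (Φ : ℤ → Set ℝ → C(ℝ, ℝ)), M.IsCrossing Φ → M.IsDense T →
        M.IsInvertible ∧
        ∀ f : E,
          (∀ g ∈ V2 lam, MemLp (voronoiOp (M.times f) g) 2 volume) ∧
          voronoiOp (M.times f) f =
            voronoiStep (M.times f) (fun n => testFun Φ (M.times f) n (M.times f n)) ∧
          (∀ k : ℕ, 1 ≤ k →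
            recon lam (M.times f) f k ∈ V2 lam ∧
            eLpNorm ((f : ℝ → ℝ) - recon lam (M.times f) f k) 2 volume ≤
              ENNReal.ofReal ((T / tau hlam) ^ k) * eLpNorm (f : ℝ → ℝ) 2 volume) ∧
          Tendsto (fun k : ℕ => eLpNorm ((f : ℝ → ℝ) - recon lam (M.times f) f k) 2 volume)
            atTop (𝓝 0) := by
  obtain ⟨hτ, hle⟩ := tau_pos_and_gFun_deriv_le hlam hA hG hG'
  have hpi := Real.pi_pos
  have hB : ∀ᵐ w, gFun hlam.memLp w ≤ ENNReal.ofReal (max B 0) :=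
    hG.mono fun w hw => hw.2.trans (ENNReal.ofReal_le_ofReal (le_max_left _ _))
  have hB0 : 0 ≤ max B 0 := le_max_right _ _
  have hK : 0 ≤ Real.pi / tau hlam := by positivity
  have hv := familyDominated_translate_unitVec hlam.memLp hB0 hB
  have hv' := familyDominated_unitVec_translate hlam.memLp hA (hG.mono fun w hw => hw.1)
  have hd := familyDominated_translate hlam.memLp_deriv hlam.memLp hK hle
  have hV2 := fun g (hg : g ∈ V2 lam) => hlam.exists_deriv_of_mem_V2 hB0 hK hv hd hg
  have hcont : ∀ g ∈ V2 lam, Continuous g := fun g hg => by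
    obtain ⟨_, G, h1, _⟩ := hV2 g hg
    exact continuous_of_sub_eq_integral h1
  have hcl := hlam.isClosed_V2L2 hB0 (inv_nonneg.2 hA.le) hv hv'
  refine ⟨hτ, fun f hf => ⟨hcont f hf, (hV2 f hf).1⟩, hcl, ?_⟩
  intro T hT E hE hEV M Φ hcross hdense
  -- Any output has a positive gap, and `E` is nonempty.
  have hT0 : 0 < T := by
    obtain ⟨f, hf⟩ := hE
    have h1 := hdense ⟨f, hf⟩ 0
    have h2 := M.strictMono ⟨f, hf⟩ (lt_add_one (0 : ℤ))
    linarith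
  set r := T / tau hlam with hr
  have hr0 : 0 ≤ r := by positivity
  have hr1 : r < 1 := (div_lt_one hτ).2 hT
  -- Wirtinger's factor T/π times Bernstein's factor π/τ gives T/τ.
  have happrox : ∀ (f : E), ∀ g ∈ V2 lam, eLpNorm (g - voronoiOp (M.times f) g) 2 volume ≤
      ENNReal.ofReal r * eLpNorm g 2 volume := fun f g hg => by
    obtain ⟨_, G, h1, h2⟩ := hV2 g hg
    refine (eLpNorm_sub_voronoiOp_le hT0 (M.strictMono f) (M.tendsto_atTop f) (M.tendsto_atBot f)
      (hdense f) (Lp.stronglyMeasurable G).measurable h1).trans ?_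
    refine (mul_le_mul_right h2 _).trans_eq ?_
    rw [← mul_assoc, ← ENNReal.ofReal_mul (by positivity), hr]
    congr 2
    field_simp
  have hmemV : ∀ (f : E), ∀ g ∈ V2 lam, MemLp (voronoiOp (M.times f) g) 2 volume := fun f g hg => by
    have hm := measurable_voronoiStep (M.strictMono f) (M.tendsto_atTop f) (M.tendsto_atBot f)
      (fun n => g (M.times f n))
    have h1 : MemLp (g - voronoiOp (M.times f) g) 2 volume :=
      ⟨(hV2 g hg).1.1.sub hm.aestronglyMeasurable, (happrox f g hg).trans_lt
        (ENNReal.mul_lt_top ENNReal.ofReal_lt_top (hV2 g hg).1.2)⟩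
    simpa using (hV2 g hg).1.sub h1
  constructor
  · refine M.isInvertible_of_injective hE fun f g hfg => ?_
    have hfV := hEV f.2
    have hgV := hEV g.2
    have hdV := (V2 lam).sub_mem hfV hgV
    -- The test functions depend only on the output, so f and g take the same value at every node.
    have hzero : voronoiOp (M.times f) (f.1 - g.1) = 0 := by
      have : ∀ n, (f.1 - g.1) (M.times f n) = 0 := fun n => by
        rw [Pi.sub_apply, (hcross f n).1, hfg, (hcross g n).1, sub_self]
      ext x
      simp [voronoiOp, voronoiStep, this]
    have h1 := happrox f _ hdV
    rw [hzero, sub_zero] at h1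
    have h2 : eLpNorm (f.1 - g.1) 2 volume = 0 := by
      by_contra h0
      have h3 : ENNReal.ofReal r * eLpNorm (f.1 - g.1) 2 volume <
          1 * eLpNorm (f.1 - g.1) 2 volume :=
        ENNReal.mul_lt_mul_left h0 (hV2 _ hdV).1.2.ne (by simpa using hr1)
      rw [one_mul] at h3
      exact absurd h1 (not_le.2 h3)
    have h3 := (eLpNorm_eq_zero_iff (hV2 _ hdV).1.1 two_ne_zero).1 h2
    -- Continuity upgrades almost everywhere equality to equality at every point.
    have h4 : f.1 - g.1 = 0 := ((hcont _ hdV).ae_eq_iff_eq volume continuous_zero).1 h3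
    exact Subtype.ext (sub_eq_zero.1 h4)
  · intro f
    have hmem : ∀ g ∈ V2 lam, opPV lam (M.times f) g ∈ V2 lam := fun g hg =>
      (isProjOf_projV2 hcl (hmemV f g hg)).1
    have hsub : ∀ g ∈ V2 lam, ∀ h ∈ V2 lam,
        opPV lam (M.times f) (g - h) =ᵐ[volume] opPV lam (M.times f) g - opPV lam (M.times f) h := by
      intro g hg h hh
      unfold opPV
      rw [voronoiOp_sub (M.strictMono f) (M.tendsto_atTop f) (M.tendsto_atBot f)]
      exact projV2_sub_ae hcl (hmemV f g hg) (hmemV f h hh)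
    have hcontr : ∀ g ∈ V2 lam, eLpNorm (g - opPV lam (M.times f) g) 2 volume ≤
        ENNReal.ofReal r * eLpNorm g 2 volume := fun g hg =>
      (eLpNorm_sub_projV2_le hcl hg (hV2 g hg).1 (hmemV f g hg)).trans (happrox f g hg)
    have hrec := recon_mem_and_eLpNorm_le hr0 hmem hsub hcontr (hEV f.2)
    refine ⟨hmemV f, ?_, fun k _ => hrec k, ?_⟩
    · exact congrArg (voronoiStep (M.times f)) (funext fun n => (hcross f n).1)
    · refine tendsto_of_tendsto_of_tendsto_of_le_of_le tendsto_const_nhds ?_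
        (fun _ => zero_le) fun k => (hrec k).2
      have h1 : Tendsto (fun k : ℕ => ENNReal.ofReal (r ^ k)) atTop (𝓝 0) := by
        simpa using ENNReal.tendsto_ofReal (tendsto_pow_atTop_nhds_zero_of_lt_one hr0 hr1)
      simpa using ENNReal.Tendsto.mul_const h1 (Or.inr (hV2 _ (hEV f.2)).1.2.ne)
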